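/- All systems are finite dimensional, logarithms are to base 2, $H(\rho)=-\mathrm{Tr}(\rho\log\rho)$ and $I(S;T)=H(S)+H(T)-H(ST)$. Let $\mathcal X$ be a finite set, $p$ a probability distribution on $\mathcal X$, and $\rho_x$ ($x\in\mathcal X$) density operators on $\mathcal H_B$; let Alice and Bob share the classical-quantum state $$\rho^{XB}=\sum_{x\in\mathcal X}p(x)\,|x\rangle\langle x|^X\otimes\rho_x^B ,$$ and let $|\psi\rangle^{XBE}$ be any purification of it. For $n\ge1$, a classical channel $Y|X^n$ with finite output alphabet, $Q(y|x^n)$, is identified with the measurement $\Lambda_y=\sum_{x^n}Q(y|x^n)|x^n\rangle\langle x^n|$ on $X^n$. Write $I(Y;B^n)$ and $I(Y;B^nE^n)$ for the mutual informations of the state of $YB^nE^n$ obtained by applying this measurement to $\psi^{\otimes n}$, and $I(Y;X^n)$ for the mutual information between the output and the input of the channel. For $R\ge0$ define $$P_n(R)=\max_{Y|X^n}\Big\{\tfrac1n I(Y;B^n)\;:\;\tfrac1n I(Y;B^nE^n)\le R\Big\},$$ $$D_n(R)=\max_{Y|X^n}\Big\{\tfrac1n I(Y;B^n)\;:\;\tfrac1n\big(I(Y;X^n)-I(Y;B^n)\big)\le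 R\Big\},$$ where the output alphabet of $Y$ is an arbitrary finite set. Then, for every $n\ge1$ and every $R\ge0$, both maxima are attained, $$P_n(D_n(R)+R)=D_n(R)\qquad\text{and}\qquad P_n(R)=P_1(R).$$ Moreover the purity tradeoff is single-letter: if $$P^{(1)}_\to(\psi^{\otimes n},R')=\sup_\Lambda\{I(Y;B^n):I(Y;B^nE^n)\le R'\},$$ where $\Lambda$ ranges over all POVMs on $X^n$ with finitely many outcomes, then for every $R\ge0$ $$\lim_{n\to\infty}\tfrac1n P^{(1)}_\to(\psi^{\otimes n},nR)=P_1(R),$$ and the maximum in $P_1(R)$ is a finite-dimensional one: it is attained by a channel with output alphabet of size $|\mathcal X|+2$. -/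

import Mathlib

open scoped Matrix Kronecker ComplexOrder Topology

noncomputable section

namespace LocalPurity

/-! Finite-dimensional quantum systems are represented by their finite sets of basis labels, states
by complex matrices, composite systems by product types, and `n` copies of a system `S` by
`Fin n → S`. Logarithms are to base 2. -/

/-- Density operators. -/
def IsDensity {S : Type*} [Fintype S] (ρ : Matrix S S ℂ) : Prop :=
  ρ.PosSemidef ∧ ρ.trace = 1

/-- The von Neumann entropy `H(ρ) = - Tr (ρ log₂ ρ)`; since `Real.logb 2 0 = 0`, the convention
`0 log 0 = 0` is built in. -/
def entropy {S : Type*} [Fintype S] [DecidableEq S] (ρ : Matrix S S ℂ) : ℝ :=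
  -(ρ * cfc (Real.logb 2) ρ).trace.re

/-- Partial trace over the second factor. -/
def traceRight {S T : Type*} [Fintype T] (M : Matrix (S × T) (S × T) ℂ) : Matrix S S ℂ :=
  Matrix.of fun s s' => ∑ t, M (s, t) (s', t)

/-- Partial trace over the first factor. -/
def traceLeft {S T : Type*} [Fintype S] (M : Matrix (S × T) (S × T) ℂ) : Matrix T T ℂ :=
  Matrix.of fun t t' => ∑ s, M (s, t) (s, t')

/-- Quantum mutual information `I(S;T) = H(S) + H(T) - H(ST)` of a state of `ST`. -/
def mutualInfo {S T : Type*} [Fintype S] [DecidableEq S] [Fintype T] [DecidableEq T]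
    (M : Matrix (S × T) (S × T) ℂ) : ℝ :=
  entropy (traceRight M) + entropy (traceLeft M) - entropy M

/-- For a state of `SBE`, the reduced state of `SB`. -/
def traceE {S B E : Type*} [Fintype E] (M : Matrix (S × B × E) (S × B × E) ℂ) :
    Matrix (S × B) (S × B) ℂ :=
  traceRight (Matrix.reindex (Equiv.prodAssoc S B E).symm (Equiv.prodAssoc S B E).symm M)

/-- The classical-quantum state `∑ₓ p(x) |x⟩⟨x| ⊗ ρₓ`. -/
def cqState {X B : Type*} [Fintype X] [DecidableEq X] (p : X → ℝ) (ρ : X → Matrix B B ℂ) :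
    Matrix (X × B) (X × B) ℂ :=
  ∑ x, (p x : ℂ) • (Matrix.single x x (1 : ℂ) ⊗ₖ ρ x)

/-- The operator `|ψ⟩⟨ψ|`. -/
def pureState {S : Type*} (ψ : S → ℂ) : Matrix S S ℂ :=
  Matrix.vecMulVec ψ (star ψ)

/-- `ψ` is a purification, on `ABE`, of the state `τ` of `AB`. -/
def IsPurification {A B E : Type*} [Fintype E] (ψ : A × B × E → ℂ)
    (τ : Matrix (A × B) (A × B) ℂ) : Prop :=
  traceE (pureState ψ) = τ

/-- `n` copies of a bipartite state, as a state of `AⁿBⁿ`. -/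
def statePow {A B : Type*} (n : ℕ) (τ : Matrix (A × B) (A × B) ℂ) :
    Matrix ((Fin n → A) × (Fin n → B)) ((Fin n → A) × (Fin n → B)) ℂ :=
  Matrix.of fun i j => ∏ k, τ (i.1 k, i.2 k) (j.1 k, j.2 k)

/-- `n` copies of a tripartite vector, as a vector of `AⁿBⁿEⁿ`. -/
def vecPow {A B E : Type*} (n : ℕ) (ψ : A × B × E → ℂ) :
    (Fin n → A) × (Fin n → B) × (Fin n → E) → ℂ :=
  fun i => ∏ k, ψ (i.1 k, i.2.1 k, i.2.2 k)

/-- POVMs on `A` with outcomes in `Y`. -/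
def IsPOVM {A Y : Type*} [DecidableEq A] [Fintype Y] (Λ : Y → Matrix A A ℂ) : Prop :=
  (∀ y, (Λ y).PosSemidef) ∧ ∑ y, Λ y = 1

/-- The state `(Λ ⊗ id)(τ) = ∑_y |y⟩⟨y| ⊗ Tr_A ((Λ_y ⊗ 1) τ)` of `YS` obtained from the state `τ`
of `AS` by measuring `A`. -/
def measured {A S Y : Type*} [Fintype A] [Fintype S] [DecidableEq S]
    [Fintype Y] [DecidableEq Y] (Λ : Y → Matrix A A ℂ) (τ : Matrix (A × S) (A × S) ℂ) :
    Matrix (Y × S) (Y × S) ℂ :=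
  ∑ y, Matrix.single y y (1 : ℂ) ⊗ₖ traceLeft ((Λ y ⊗ₖ (1 : Matrix S S ℂ)) * τ)

/-- `Q x y` is the probability of the output `y` on the input `x` of a classical channel `Y|X`. -/
def IsChannel {X Y : Type*} [Fintype Y] (Q : X → Y → ℝ) : Prop :=
  ∀ x, Q x ∈ stdSimplex ℝ Y

/-- A classical channel `Y|X` acting on the preferred basis of `X`, as the measurement
`Λ_y = ∑ₓ Q(y|x) |x⟩⟨x|`. -/
def channelPOVM {X Y : Type*} [DecidableEq X] (Q : X → Y → ℝ) : Y → Matrix X X ℂ :=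
  fun y => Matrix.diagonal fun x => (Q x y : ℂ)

/-- The (classical) joint state `∑ Q(y|x) ⟨x|ρˣ|x⟩ |y⟩⟨y| ⊗ |x⟩⟨x|` of the output `Y` and the
input `X` of a channel, for the state `τ` of `XB`. -/
def jointYX {X B Y : Type*} [DecidableEq X] [Fintype B] [DecidableEq Y]
    (Q : X → Y → ℝ) (τ : Matrix (X × B) (X × B) ℂ) : Matrix (Y × X) (Y × X) ℂ :=
  Matrix.diagonal fun i => (Q i.2 i.1 : ℂ) * traceRight τ i.2 i.2

section Quantities

variable {X B E : Type*} [Fintype X] [DecidableEq X] [Fintype B] [DecidableEq B]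
  [Fintype E] [DecidableEq E]

/-- The information `I(Y;BE)` after a measurement of `A` in the pure state `ψ` of `ABE`. -/
def infoYBE {m : ℕ} (Λ : Fin m → Matrix X X ℂ) (ψ : X × B × E → ℂ) : ℝ :=
  mutualInfo (measured Λ (pureState ψ))

/-- The information `I(Y;B)` after a measurement of `A` in the pure state `ψ` of `ABE`. -/
def infoYB {m : ℕ} (Λ : Fin m → Matrix X X ℂ) (ψ : X × B × E → ℂ) : ℝ :=
  mutualInfo (traceE (measured Λ (pureState ψ)))

/-- The values `I(Y;Bⁿ)/n` over all channels `Y|Xⁿ`, with any finite output alphabet, such that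
`I(Y;BⁿEⁿ)/n ≤ R`; here `ψ` is a purification of the state of `XB`. -/
def purityValues (n : ℕ) (ψ : X × B × E → ℂ) (R : ℝ) : Set ℝ :=
  {v | ∃ (m : ℕ) (Q : (Fin n → X) → Fin m → ℝ), IsChannel Q ∧
    1 / (n : ℝ) * infoYBE (channelPOVM Q) (vecPow n ψ) ≤ R ∧
    v = 1 / (n : ℝ) * infoYB (channelPOVM Q) (vecPow n ψ)}

/-- `P_n(R)`. -/
def purity (n : ℕ) (ψ : X × B × E → ℂ) (R : ℝ) : ℝ :=
  sSup (purityValues n ψ R)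

/-- The values `I(Y;Bⁿ)/n` over all channels `Y|Xⁿ`, with any finite output alphabet, such that
`(I(Y;Xⁿ) - I(Y;Bⁿ))/n ≤ R`, for the state `τ` of `XB`. -/
def crValues (n : ℕ) (τ : Matrix (X × B) (X × B) ℂ) (R : ℝ) : Set ℝ :=
  {v | ∃ (m : ℕ) (Q : (Fin n → X) → Fin m → ℝ), IsChannel Q ∧
    1 / (n : ℝ) * (mutualInfo (jointYX Q (statePow n τ)) -
      mutualInfo (measured (channelPOVM Q) (statePow n τ))) ≤ R ∧
    v = 1 / (n : ℝ) * mutualInfo (measured (channelPOVM Q) (statePow n τ))}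

/-- `D_n(R)`. -/
def commonRandomness (n : ℕ) (τ : Matrix (X × B) (X × B) ℂ) (R : ℝ) : ℝ :=
  sSup (crValues n τ R)

/-- The quantity `max {I(Y;B) : I(Y;BE) ≤ R}` over all POVMs on the first system, with any finite
set of outcomes, for the pure state `ψ`. -/
def povmPurity (ψ : X × B × E → ℂ) (R : ℝ) : ℝ :=
  sSup {v | ∃ (m : ℕ) (Λ : Fin m → Matrix X X ℂ), IsPOVM Λ ∧
    infoYBE Λ ψ ≤ R ∧ v = infoYB Λ ψ}

end Quantities

end LocalPurity

end

/-!
For a purification `ψ` of a classical-quantum state, the state of `BE` conditional on an outcome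
of a channel `Y|X` has the same nonzero spectrum as the conditional distribution of `X`
(`entropy_amplitude_mul`), so `I(Y;BE) = I(Y;X)` (`infoYBE_channelPOVM`). Both tradeoffs thus
concern `I(Y;X)` (`inputInfo`) and `I(Y;B)` (`outputInfo`) only, and `P(D(R) + R) = D(R)` says
that they are one curve in two coordinate systems (`outputInfo_optimal_eq`). A general POVM has
the same `I(Y;B)` as its diagonal, and an `I(Y;BE)` at least as large, because pinching does not
decrease the entropy (`inputInfo_le_infoYBE`); hence POVMs are no better than channels.

The maxima exist because the conditional entropies are sums over the outputs `y` of functions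
homogeneous in `Q(y|·)`: Carathéodory's theorem for cones reduces the output alphabet to `|X| + 2`
letters (`exists_channel_card`), and then the channels form a compact set on which the
informations are continuous.

Additivity rests on a two-copy statement. For independent sources `X₁ → B₁`, `X₂ → B₂`,
`I(Y;X₁X₂) = I(Y;X₁) + I(YX₁;X₂)` (`inputInfo_prodDist`), while
`I(Y;B₁B₂) ≤ I(Y;B₁) + I(YX₁;B₂)` (`outputInfo_prod_le`). The inequality amounts to `H(B₂|B₁) ≥ H(B₂|X₁)` for each value of `Y`,
that is, to a lower bound for the conditional entropy of a separable state
(`entropy_add_sum_le_entropy_sum_kronecker`). It follows from the joint subadditivity of the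
relative entropy (`SpectralPair.relEntropy_le_sum`), which is obtained from the integral
representation of the logarithm: up to normalization, `Tr ρ (ln ρ - ln σ)` is the integral over
`t` of `⟨ρ, (L_σ + t R_ρ)⁻¹ ρ⟩`, and the integrand is a maximum of functionals linear in `(ρ, σ)`.
Induction on `n` and time sharing then turn a channel on `n` copies into one on a single copy
(`exists_single_letter`).
-/

namespace LocalPurity

/-! ### Entropy of Hermitian matrices -/

/-- The function `x ↦ -x log₂ x`. -/
noncomputable def eta (x : ℝ) : ℝ := -(x * Real.logb 2 x)

theorem eta_eq (x : ℝ) : eta x = (Real.log 2)⁻¹ * Real.negMulLog x := by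
  simp only [eta, Real.negMulLog, Real.logb]; ring

@[simp] theorem eta_zero : eta 0 = 0 := by simp [eta]

@[simp] theorem eta_one : eta 1 = 0 := by simp [eta]

theorem continuous_eta : Continuous eta := by
  have : eta = fun x => (Real.log 2)⁻¹ * Real.negMulLog x := funext eta_eq
  rw [this]
  exact continuous_const.mul Real.continuous_negMulLog

theorem eta_mul (x y : ℝ) : eta (x * y) = y * eta x + x * eta y := by
  rcases eq_or_ne x 0 with rfl | hx
  · simp
  rcases eq_or_ne y 0 with rfl | hy
  · simp
  simp only [eta, Real.logb_mul hx hy]; ring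

theorem concaveOn_eta : ConcaveOn ℝ (Set.Ici 0) eta := by
  have : eta = fun x => (Real.log 2)⁻¹ • Real.negMulLog x := funext fun x => by
    simp [eta_eq]
  rw [this]
  exact Real.concaveOn_negMulLog.smul (by positivity)

section Entropy

variable {S T : Type*} [Fintype S] [DecidableEq S] [Fintype T] [DecidableEq T]

omit [DecidableEq S] in
theorem trace_eq_re {M : Matrix S S ℂ} (hM : M.IsHermitian) : M.trace = (M.trace.re : ℂ) := by
  have h : star M.trace = M.trace := by rw [← Matrix.trace_conjTranspose, hM]
  exact (Complex.conj_eq_iff_re.1 h).symm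

theorem exists_unitary_diagonal {M : Matrix S S ℂ} (hM : M.IsHermitian) :
    ∃ U ∈ Matrix.unitaryGroup S ℂ,
      M = U * Matrix.diagonal (fun i => (hM.eigenvalues i : ℂ)) * Uᴴ := by
  refine ⟨hM.eigenvectorUnitary, hM.eigenvectorUnitary.2, ?_⟩
  conv_lhs => rw [hM.spectral_theorem, Unitary.conjStarAlgAut_apply]
  rfl

theorem trace_unitary_conj {U : Matrix S S ℂ} (hU : U ∈ Matrix.unitaryGroup S ℂ)
    (D : Matrix S S ℂ) : (U * D * Uᴴ).trace = D.trace := by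
  rw [Matrix.trace_mul_comm, ← mul_assoc]
  have : Uᴴ * U = 1 := (Matrix.mem_unitaryGroup_iff').1 hU
  rw [this, one_mul]

theorem trace_cfc {M : Matrix S S ℂ} (hM : M.IsHermitian) (f : ℝ → ℝ) :
    (cfc f M).trace = ∑ i, (f (hM.eigenvalues i) : ℂ) := by
  rw [hM.cfc_eq, Matrix.IsHermitian.cfc, Unitary.conjStarAlgAut_apply]
  refine (trace_unitary_conj hM.eigenvectorUnitary.2 _).trans ?_
  simp [Matrix.trace]

theorem entropy_eq_trace_cfc {M : Matrix S S ℂ} (hM : M.IsHermitian) :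
    entropy M = (cfc eta M).trace.re := by
  have h1 : cfc eta M = -(M * cfc (Real.logb 2) M) := by
    have hfin : (spectrum ℝ M).Finite := by
      rw [hM.spectrum_real_eq_range_eigenvalues]; exact Set.finite_range _
    have hc : ContinuousOn (Real.logb 2) (spectrum ℝ M) := hfin.continuousOn _
    have hs : IsSelfAdjoint M := hM
    have h2 := cfc_mul (fun x => x) (Real.logb 2) M (hfin.continuousOn _) hc
    rw [cfc_id' ℝ M hs] at h2
    rw [← h2, ← cfc_neg]
    rfl
  rw [h1]; simp [entropy]

theorem entropy_eq_sum_eigenvalues {M : Matrix S S ℂ} (hM : M.IsHermitian) :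
    entropy M = ∑ i, eta (hM.eigenvalues i) := by
  rw [entropy_eq_trace_cfc hM, trace_cfc hM]; simp

omit [DecidableEq T] in
open Polynomial in
/-- The entropy only depends on the nonzero roots of the characteristic polynomial. -/
theorem entropy_eq_sum_of_charpoly {M : Matrix S S ℂ} (hM : M.IsHermitian) (d : T → ℝ) {k l : ℕ}
    (h : X ^ k * M.charpoly = X ^ l * ∏ i, (X - C (d i : ℂ))) :
    entropy M = ∑ i, eta (d i) := by
  have hr := congrArg Polynomial.roots h
  have h1 : (∏ i, (X - C (d i : ℂ))) ≠ 0 :=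
    (monic_prod_of_monic _ _ fun i _ => monic_X_sub_C _).ne_zero
  rw [roots_mul (mul_ne_zero (pow_ne_zero _ X_ne_zero) M.charpoly_monic.ne_zero),
    roots_mul (mul_ne_zero (pow_ne_zero _ X_ne_zero) h1), roots_X_pow, roots_X_pow,
    hM.roots_charpoly_eq_eigenvalues, roots_prod _ _ h1] at hr
  have h2 := congrArg (fun m => (m.map fun z : ℂ => eta z.re).sum) hr
  simpa [entropy_eq_sum_eigenvalues hM, Multiset.nsmul_singleton, Multiset.bind_singleton,
    Function.comp_def] using h2

theorem entropy_unitary_diagonal {U : Matrix S S ℂ} (hU : U ∈ Matrix.unitaryGroup S ℂ)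
    (d : S → ℝ) : entropy (U * Matrix.diagonal (fun i => (d i : ℂ)) * Uᴴ) = ∑ i, eta (d i) := by
  refine entropy_eq_sum_of_charpoly (k := 0) (l := 0) ?_ d ?_
  · refine Matrix.isHermitian_mul_mul_conjTranspose _ ?_
    simp [Matrix.IsHermitian, Matrix.diagonal_conjTranspose, Pi.star_def]
  · have hU' : Uᴴ * U = 1 := (Matrix.mem_unitaryGroup_iff').1 hU
    rw [Matrix.charpoly_mul_comm, ← mul_assoc, hU', one_mul,
      Matrix.charpoly_diagonal]

theorem entropy_diagonal (d : S → ℝ) :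
    entropy (Matrix.diagonal fun i => (d i : ℂ)) = ∑ i, eta (d i) := by
  simpa using entropy_unitary_diagonal (one_mem (Matrix.unitaryGroup S ℂ)) d

theorem entropy_reindex (e : S ≃ T) {M : Matrix S S ℂ} (hM : M.IsHermitian) :
    entropy (Matrix.reindex e e M) = entropy M := by
  rw [entropy_eq_sum_eigenvalues hM]
  refine entropy_eq_sum_of_charpoly (k := 0) (l := 0) ?_ _ ?_
  · exact hM.submatrix _
  · rw [Matrix.charpoly_reindex, hM.charpoly_eq]; rfl

theorem entropy_mul_comm {A : Matrix S T ℂ} {B : Matrix T S ℂ} (h1 : (A * B).IsHermitian)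
    (h2 : (B * A).IsHermitian) : entropy (A * B) = entropy (B * A) := by
  rw [entropy_eq_sum_eigenvalues h2]
  refine entropy_eq_sum_of_charpoly (k := Fintype.card T) (l := Fintype.card S) h1 _ ?_
  rw [Matrix.charpoly_mul_comm', h2.charpoly_eq]; rfl

theorem entropy_smul (c : ℝ) {M : Matrix S S ℂ} (hM : M.IsHermitian) :
    entropy ((c : ℂ) • M) = c * entropy M + M.trace.re * eta c := by
  obtain ⟨U, hU, h⟩ := exists_unitary_diagonal hM
  have h1 : (c : ℂ) • M = U * Matrix.diagonal (fun i => ((c * hM.eigenvalues i : ℝ) : ℂ)) * Uᴴ := by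
    conv_lhs => rw [h]
    rw [← Matrix.smul_mul, ← Matrix.mul_smul, ← Matrix.diagonal_smul]
    simp [Pi.smul_def]
  rw [h1, entropy_unitary_diagonal hU, entropy_eq_sum_eigenvalues hM, hM.trace_eq_sum_eigenvalues]
  simp only [eta_mul, Finset.sum_add_distrib, ← Finset.mul_sum, ← Finset.sum_mul]
  simp; ring

theorem entropy_kronecker {M : Matrix S S ℂ} {N : Matrix T T ℂ} (hM : M.IsHermitian)
    (hN : N.IsHermitian) :
    entropy (M ⊗ₖ N) = N.trace.re * entropy M + M.trace.re * entropy N := by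
  obtain ⟨U, hU, h⟩ := exists_unitary_diagonal hM
  obtain ⟨V, hV, h'⟩ := exists_unitary_diagonal hN
  have h1 : M ⊗ₖ N = (U ⊗ₖ V) * Matrix.diagonal
      (fun i : S × T => ((hM.eigenvalues i.1 * hN.eigenvalues i.2 : ℝ) : ℂ)) * (U ⊗ₖ V)ᴴ := by
    conv_lhs => rw [h, h']
    rw [Matrix.mul_kronecker_mul, Matrix.mul_kronecker_mul, Matrix.diagonal_kronecker_diagonal,
      Matrix.conjTranspose_kronecker]
    simp
  rw [h1, entropy_unitary_diagonal (Matrix.kronecker_mem_unitary hU hV),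
    entropy_eq_sum_eigenvalues hM, entropy_eq_sum_eigenvalues hN, hM.trace_eq_sum_eigenvalues,
    hN.trace_eq_sum_eigenvalues, Fintype.sum_prod_type]
  simp only [eta_mul, Finset.sum_add_distrib, ← Finset.mul_sum, ← Finset.sum_mul]
  simp

theorem continuous_entropy {Z : Type*} [TopologicalSpace Z] {f : Z → Matrix S S ℂ}
    (hf : Continuous f) (hH : ∀ z, (f z).IsHermitian) : Continuous fun z => entropy (f z) := by
  open scoped Matrix.Norms.L2Operator in
  have h : Continuous fun z => cfc eta (f z) :=
    Continuous.cfc_of_mem_nhdsSet (s := Set.univ) eta Filter.univ_mem hf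
      (fun z => hH z) continuous_eta.continuousOn
  have h2 : (fun z => entropy (f z)) = fun z => (cfc eta (f z)).trace.re :=
    funext fun z => entropy_eq_trace_cfc (hH z)
  rw [h2]
  exact Complex.continuous_re.comp h.matrix_trace

/-- Pinching to the diagonal does not decrease the entropy: the diagonal is the image of the
spectrum under a doubly stochastic matrix. -/
theorem entropy_le_sum_diag {M : Matrix S S ℂ} (hM : M.PosSemidef) :
    entropy M ≤ ∑ i, eta (M i i).re := by
  obtain ⟨U, hU, h⟩ := exists_unitary_diagonal hM.isHermitian
  set l := hM.isHermitian.eigenvalues with hl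
  have hpos : ∀ i, 0 ≤ l i := hM.eigenvalues_nonneg
  have hd : ∀ i, (M i i).re = ∑ j, Complex.normSq (U i j) • l j := by
    intro i
    have : M i i = ∑ j, ((Complex.normSq (U i j) * l j : ℝ) : ℂ) := by
      conv_lhs => rw [h]
      rw [Matrix.mul_apply]
      refine Finset.sum_congr rfl fun j _ => ?_
      rw [Matrix.mul_diagonal, Matrix.conjTranspose_apply, Complex.ofReal_mul,
        Complex.normSq_eq_conj_mul_self]
      simp only [Complex.star_def]; ring
    rw [this, ← Complex.ofReal_sum, Complex.ofReal_re]; rfl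
  have hrow : ∀ i, ∑ j, Complex.normSq (U i j) = 1 := by
    intro i
    have := congrFun (congrFun ((Matrix.mem_unitaryGroup_iff).1 hU) i) i
    rw [Matrix.mul_apply, Matrix.one_apply_eq] at this
    have h2 : ((∑ j, Complex.normSq (U i j) : ℝ) : ℂ) = 1 := by
      rw [← this]; push_cast
      refine Finset.sum_congr rfl fun j _ => ?_
      rw [Matrix.star_apply, Complex.star_def, Complex.mul_conj]
    exact_mod_cast h2
  have hcol : ∀ j, ∑ i, Complex.normSq (U i j) = 1 := by
    intro i
    have := congrFun (congrFun ((Matrix.mem_unitaryGroup_iff').1 hU) i) i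
    rw [Matrix.mul_apply, Matrix.one_apply_eq] at this
    have h2 : ((∑ j, Complex.normSq (U j i) : ℝ) : ℂ) = 1 := by
      rw [← this]; push_cast
      refine Finset.sum_congr rfl fun j _ => ?_
      rw [Matrix.star_apply, Complex.star_def, Complex.normSq_eq_conj_mul_self]
    exact_mod_cast h2
  rw [entropy_eq_sum_eigenvalues hM.isHermitian, ← hl]
  calc ∑ j, eta (l j) = ∑ j, ∑ i, Complex.normSq (U i j) * eta (l j) := by
        refine Finset.sum_congr rfl fun j _ => ?_
        rw [← Finset.sum_mul, hcol, one_mul]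
    _ = ∑ i, ∑ j, Complex.normSq (U i j) • eta (l j) := by
        rw [Finset.sum_comm]; rfl
    _ ≤ ∑ i, eta (M i i).re := by
        refine Finset.sum_le_sum fun i _ => ?_
        rw [hd]
        exact concaveOn_eta.le_map_sum (fun j _ => Complex.normSq_nonneg _) (hrow i)
          (fun j _ => hpos j)

omit [Fintype S] [DecidableEq S] in
theorem sum_single_kronecker_apply (M : T → Matrix S S ℂ) (i j : T × S) :
    (∑ y, Matrix.single y y (1 : ℂ) ⊗ₖ M y) i j = if i.1 = j.1 then M i.1 i.2 j.2 else 0 := by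
  rw [Matrix.sum_apply]
  simp only [Matrix.kroneckerMap_apply, Matrix.single_apply]
  split_ifs with h
  · rw [Finset.sum_eq_single i.1]
    · simp [h]
    · intro y _ hy; simp [hy]
    · simp
  · refine Finset.sum_eq_zero fun y _ => ?_
    rw [if_neg (by rintro ⟨rfl, h2⟩; exact h h2), zero_mul]

omit [Fintype S] [DecidableEq S] in
theorem isHermitian_sum_single_kronecker {M : T → Matrix S S ℂ} (hM : ∀ y, (M y).IsHermitian) :
    (∑ y, Matrix.single y y (1 : ℂ) ⊗ₖ M y).IsHermitian := by
  refine Matrix.IsHermitian.ext fun i j => ?_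
  simp only [sum_single_kronecker_apply]
  by_cases h : i.1 = j.1
  · simp [h, (hM _).apply]
  · simp [h, Ne.symm h]

theorem entropy_sum_single_kronecker {M : T → Matrix S S ℂ} (hM : ∀ y, (M y).IsHermitian) :
    entropy (∑ y, Matrix.single y y (1 : ℂ) ⊗ₖ M y) = ∑ y, entropy (M y) := by
  have h := Fintype.sum_prod_type fun i : T × S => eta ((hM i.1).eigenvalues i.2)
  simp only [entropy_eq_sum_eigenvalues (hM _)]
  rw [← h]
  refine entropy_eq_sum_of_charpoly (k := 0) (l := 0) (isHermitian_sum_single_kronecker hM) _ ?_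
  rw [pow_zero, one_mul, one_mul, Fintype.prod_prod_type]
  have hb : (∑ y, Matrix.single y y (1 : ℂ) ⊗ₖ M y) =
      Matrix.reindex (Equiv.prodComm S T) (Equiv.prodComm S T) (Matrix.blockDiagonal M) := by
    ext i j
    rw [sum_single_kronecker_apply]
    simp [Matrix.blockDiagonal_apply]
  rw [hb, Matrix.charpoly_reindex, Matrix.charpoly]
  have hc : (Matrix.blockDiagonal M).charmatrix =
      Matrix.blockDiagonal fun y => (M y).charmatrix := by
    ext i j : 1
    simp only [Matrix.charmatrix_apply, Matrix.blockDiagonal_apply, Matrix.diagonal_apply,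
      Prod.ext_iff]
    split_ifs <;> simp_all
  rw [hc, Matrix.det_blockDiagonal]
  exact Finset.prod_congr rfl fun y _ => (hM y).charpoly_eq

end Entropy

/-! ### Joint subadditivity of the relative entropy -/

section RelativeEntropy

variable {S : Type*} [Fintype S] [DecidableEq S]

/-- A pair of positive semidefinite matrices `left`, `right` given by spectral decompositions, such
that the support of `left` is contained in that of `right`. -/
structure SpectralPair (S : Type*) [Fintype S] [DecidableEq S] where
  /-- Eigenbasis of the first matrix. -/
  U : Matrix S S ℂ
  /-- Eigenbasis of the second matrix. -/
  W : Matrix S S ℂ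
  /-- Eigenvalues of the first matrix. -/
  a : S → ℝ
  /-- Eigenvalues of the second matrix. -/
  b : S → ℝ
  U_mem : U ∈ Matrix.unitaryGroup S ℂ
  W_mem : W ∈ Matrix.unitaryGroup S ℂ
  a_nonneg : ∀ i, 0 ≤ a i
  b_nonneg : ∀ j, 0 ≤ b j
  support : ∀ i j, b j = 0 → Complex.normSq ((Uᴴ * W) i j) * a i = 0

namespace SpectralPair

variable (P : SpectralPair S)

/-- The first matrix of the pair. -/
noncomputable def left : Matrix S S ℂ :=
  P.U * Matrix.diagonal (fun i => (P.a i : ℂ)) * P.Uᴴ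

/-- The second matrix of the pair. -/
noncomputable def right : Matrix S S ℂ :=
  P.W * Matrix.diagonal (fun i => (P.b i : ℂ)) * P.Wᴴ

/-- Squared overlaps of the two eigenbases. -/
noncomputable def overlap (i j : S) : ℝ := Complex.normSq ((P.Uᴴ * P.W) i j)

/-- The relative entropy `Tr ρ (ln ρ - ln σ)` of the pair. -/
noncomputable def relEntropy : ℝ :=
  ∑ i, ∑ j, P.overlap i j * P.a i * (Real.log (P.a i) - Real.log (P.b j))

/-- The integral over `0 ≤ t ≤ T` of `P.resolvent t`; up to a multiple of `ln T` it converges to the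
relative entropy as `T → ∞`. -/
noncomputable def truncated (T : ℝ) : ℝ :=
  ∑ i, ∑ j, P.overlap i j * P.a i * (Real.log (P.b j + T * P.a i) - Real.log (P.b j))

/-- The quadratic expression `⟨ρ, (L_σ + t R_ρ)⁻¹ ρ⟩`, where `L_σ` and `R_ρ` are the
multiplications by `σ` from the left and by `ρ` from the right. -/
noncomputable def resolvent (t : ℝ) : ℝ :=
  ∑ i, ∑ j, P.overlap i j * (P.a i ^ 2 / (P.b j + t * P.a i))

end SpectralPair

/-- The functional `2 Re ⟨Z, ρ⟩ - ⟨Z, (L_σ + t R_ρ) Z⟩` up to taking adjoints; it is linear in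
`(ρ, σ)`, and its maximum over `Z` is `⟨ρ, (L_σ + t R_ρ)⁻¹ ρ⟩`. -/
noncomputable def dualForm (t : ℝ) (Z ρ σ : Matrix S S ℂ) : ℝ :=
  2 * (Zᴴ * ρ).trace.re - (Z * σ * Zᴴ).trace.re - t * (Zᴴ * ρ * Z).trace.re

omit [DecidableEq S] in
theorem dualForm_sum {K : Type*} [Fintype K] (t : ℝ) (Z : Matrix S S ℂ) (ρ σ : K → Matrix S S ℂ) :
    dualForm t Z (∑ k, ρ k) (∑ k, σ k) = ∑ k, dualForm t Z (ρ k) (σ k) := by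
  simp only [dualForm, Finset.mul_sum, Finset.sum_mul, Matrix.trace_sum, Complex.re_sum,
    Finset.sum_sub_distrib]

namespace SpectralPair

variable (P : SpectralPair S)

/-- In the two eigenbases the dual form is a sum over matrix entries. -/
theorem dualForm_eq (t : ℝ) (z : Matrix S S ℂ) :
    dualForm t (P.U * z * P.Wᴴ) P.left P.right =
      ∑ i, ∑ j, (2 * (P.a i * (star (z i j) * (P.Uᴴ * P.W) i j).re) -
        Complex.normSq (z i j) * (P.b j + t * P.a i)) := by
  have hU : P.Uᴴ * P.U = 1 := (Matrix.mem_unitaryGroup_iff').1 P.U_mem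
  have hW : P.Wᴴ * P.W = 1 := (Matrix.mem_unitaryGroup_iff').1 P.W_mem
  set A := Matrix.diagonal (fun i => (P.a i : ℂ)) with hA
  set B := Matrix.diagonal (fun i => (P.b i : ℂ)) with hB
  have hZ : (P.U * z * P.Wᴴ)ᴴ = P.W * zᴴ * P.Uᴴ := by
    simp [Matrix.conjTranspose_mul, mul_assoc]
  have h1 : ((P.U * z * P.Wᴴ)ᴴ * P.left).trace = (zᴴ * (A * (P.Uᴴ * P.W))).trace := by
    have : (P.U * z * P.Wᴴ)ᴴ * P.left = P.W * (zᴴ * (A * P.Uᴴ)) := by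
      rw [hZ, left]
      calc _ = P.W * zᴴ * (P.Uᴴ * P.U) * A * P.Uᴴ := by simp only [mul_assoc]; rfl
        _ = _ := by rw [hU, mul_one]; simp only [mul_assoc]
    rw [this, Matrix.trace_mul_comm]; simp only [mul_assoc]
  have h2 : (P.U * z * P.Wᴴ * P.right * (P.U * z * P.Wᴴ)ᴴ).trace = (zᴴ * (z * B)).trace := by
    have : P.U * z * P.Wᴴ * P.right * (P.U * z * P.Wᴴ)ᴴ = P.U * (z * B * zᴴ) * P.Uᴴ := by
      rw [hZ, right]
      calc _ = P.U * z * (P.Wᴴ * P.W) * B * (P.Wᴴ * P.W) * zᴴ * P.Uᴴ := by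
            simp only [mul_assoc]; rfl
        _ = _ := by rw [hW, mul_one, mul_one]; simp only [mul_assoc]
    rw [this, trace_unitary_conj P.U_mem, Matrix.trace_mul_comm]
  have h3 : ((P.U * z * P.Wᴴ)ᴴ * P.left * (P.U * z * P.Wᴴ)).trace = (zᴴ * (A * z)).trace := by
    have : (P.U * z * P.Wᴴ)ᴴ * P.left * (P.U * z * P.Wᴴ) = P.W * (zᴴ * (A * z)) * P.Wᴴ := by
      rw [hZ, left]
      calc _ = P.W * zᴴ * (P.Uᴴ * P.U) * A * (P.Uᴴ * P.U) * z * P.Wᴴ := by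
            simp only [mul_assoc]; rfl
        _ = _ := by rw [hU, mul_one, mul_one]; simp only [mul_assoc]
    rw [this, trace_unitary_conj P.W_mem]
  have key : ∀ M : Matrix S S ℂ, (zᴴ * M).trace.re = ∑ i, ∑ j, (star (z i j) * M i j).re := by
    intro M
    rw [Matrix.trace, Complex.re_sum, Finset.sum_comm]
    refine Finset.sum_congr rfl fun j _ => ?_
    rw [Matrix.diag_apply, Matrix.mul_apply, Complex.re_sum]
    rfl
  rw [dualForm, h1, h2, h3, key, key, key]
  simp only [Finset.mul_sum, ← Finset.sum_sub_distrib]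
  refine Finset.sum_congr rfl fun i _ => Finset.sum_congr rfl fun j _ => ?_
  simp only [hA, hB, Matrix.diagonal_mul, Matrix.mul_diagonal, Complex.star_def, Complex.mul_re,
    Complex.mul_im, Complex.conj_re, Complex.conj_im, Complex.ofReal_re, Complex.ofReal_im,
    Complex.normSq_apply]
  ring

/-- Weak duality, by completing the square in each entry of `Uᴴ Z W`. -/
theorem dualForm_le_resolvent {t : ℝ} (ht : 0 < t) (Z : Matrix S S ℂ) :
    dualForm t Z P.left P.right ≤ P.resolvent t := by
  have hU : P.U * P.Uᴴ = 1 := (Matrix.mem_unitaryGroup_iff).1 P.U_mem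
  have hW : P.W * P.Wᴴ = 1 := (Matrix.mem_unitaryGroup_iff).1 P.W_mem
  have hZ : Z = P.U * (P.Uᴴ * Z * P.W) * P.Wᴴ := by
    calc Z = (P.U * P.Uᴴ) * Z * (P.W * P.Wᴴ) := by rw [hU, hW, one_mul, mul_one]
      _ = _ := by simp only [mul_assoc]
  rw [hZ, dualForm_eq, resolvent]
  refine Finset.sum_le_sum fun i _ => Finset.sum_le_sum fun j _ => ?_
  generalize (P.Uᴴ * Z * P.W) i j = z
  rw [overlap]
  generalize (P.Uᴴ * P.W) i j = c
  have ha := P.a_nonneg i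
  have hb := P.b_nonneg j
  rcases (add_nonneg hb (mul_nonneg ht.le ha)).eq_or_lt with hd | hd
  · have : P.a i = 0 := by
      have : t * P.a i = 0 := by nlinarith [mul_nonneg ht.le ha]
      simpa [ht.ne'] using this
    rw [← hd]; simp [this]
  · have hsq := Complex.normSq_nonneg (((P.b j + t * P.a i : ℝ) : ℂ) * z - (P.a i : ℂ) * c)
    rw [mul_div_assoc', le_div_iff₀ hd]
    simp only [Complex.normSq_apply, Complex.star_def, Complex.mul_re, Complex.mul_im,
      Complex.sub_re, Complex.sub_im, Complex.conj_re, Complex.conj_im, Complex.ofReal_re,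
      Complex.ofReal_im] at hsq ⊢
    nlinarith [hsq]

theorem exists_dualForm_eq_resolvent {t : ℝ} (ht : 0 < t) :
    ∃ Z, dualForm t Z P.left P.right = P.resolvent t := by
  refine ⟨P.U * (Matrix.of fun i j => ((P.a i / (P.b j + t * P.a i) : ℝ) : ℂ) * (P.Uᴴ * P.W) i j) *
    P.Wᴴ, ?_⟩
  rw [dualForm_eq, resolvent]
  refine Finset.sum_congr rfl fun i _ => Finset.sum_congr rfl fun j _ => ?_
  rw [overlap, Matrix.of_apply]
  generalize (P.Uᴴ * P.W) i j = c
  have ha := P.a_nonneg i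
  have hb := P.b_nonneg j
  rcases (add_nonneg hb (mul_nonneg ht.le ha)).eq_or_lt with hd | hd
  · rw [← hd]; simp
  · simp only [Complex.normSq_apply, Complex.star_def, Complex.mul_re, Complex.mul_im,
      Complex.conj_re, Complex.conj_im, Complex.ofReal_re,
      Complex.ofReal_im]
    generalize P.b j + t * P.a i = d at hd
    field_simp
    ring

theorem sum_overlap (i : S) : ∑ j, P.overlap i j = 1 := by
  have hW : P.W * P.Wᴴ = 1 := (Matrix.mem_unitaryGroup_iff).1 P.W_mem
  have hU : P.Uᴴ * P.U = 1 := (Matrix.mem_unitaryGroup_iff').1 P.U_mem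
  have h1 : (P.Uᴴ * P.W) * (P.Uᴴ * P.W)ᴴ = 1 := by
    calc _ = P.Uᴴ * (P.W * P.Wᴴ) * P.U := by
          simp only [Matrix.conjTranspose_mul, Matrix.conjTranspose_conjTranspose, mul_assoc]
      _ = 1 := by rw [hW, mul_one, hU]
  have := congrFun (congrFun h1 i) i
  rw [Matrix.mul_apply, Matrix.one_apply_eq] at this
  have h2 : ((∑ j, P.overlap i j : ℝ) : ℂ) = 1 := by
    rw [← this]; push_cast
    refine Finset.sum_congr rfl fun j _ => ?_
    rw [Matrix.conjTranspose_apply, Complex.star_def, Complex.mul_conj]; rfl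
  exact_mod_cast h2

theorem trace_left : P.left.trace.re = ∑ i, ∑ j, P.overlap i j * P.a i := by
  rw [left, trace_unitary_conj P.U_mem]
  simp only [← Finset.sum_mul, P.sum_overlap, one_mul]
  simp [Matrix.trace]

theorem truncated_zero : P.truncated 0 = 0 := by simp [truncated]

theorem hasDerivAt_truncated {T : ℝ} (hT : 0 ≤ T) :
    HasDerivAt P.truncated (P.resolvent T) T := by
  unfold truncated resolvent
  refine HasDerivAt.fun_sum fun i _ => HasDerivAt.fun_sum fun j _ => ?_
  rcases eq_or_ne (P.overlap i j * P.a i) 0 with h0 | h0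
  · have h1 : P.overlap i j * (P.a i ^ 2 / (P.b j + T * P.a i)) = 0 := by
      rw [pow_two, mul_div_assoc', ← mul_assoc, h0, zero_mul, zero_div]
    rw [h1]
    simpa [h0] using hasDerivAt_const T (0 : ℝ)
  · have hb : 0 < P.b j := lt_of_le_of_ne (P.b_nonneg j) fun h => h0 (P.support i j h.symm)
    have hpos : 0 < P.b j + T * P.a i := by
      have := mul_nonneg hT (P.a_nonneg i); linarith
    have h1 : HasDerivAt (fun T => P.b j + T * P.a i) (P.a i) T := by
      simpa using ((hasDerivAt_id T).mul_const (P.a i)).const_add (P.b j)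
    have h2 := ((h1.log hpos.ne').sub_const (Real.log (P.b j))).const_mul (P.overlap i j * P.a i)
    exact h2.congr_deriv (by ring)

theorem tendsto_truncated :
    Filter.Tendsto (fun T => P.truncated T - P.left.trace.re * Real.log T) Filter.atTop
      (𝓝 P.relEntropy) := by
  simp only [truncated, trace_left, relEntropy, Finset.sum_mul, ← Finset.sum_sub_distrib]
  refine tendsto_finsetSum _ fun i _ => tendsto_finsetSum _ fun j _ => ?_
  rcases eq_or_ne (P.overlap i j * P.a i) 0 with h0 | h0
  · simp [h0]
  · have ha : 0 < P.a i := lt_of_le_of_ne (P.a_nonneg i) fun h => h0 (by rw [← h, mul_zero])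
    have h1 : Filter.Tendsto (fun T : ℝ => P.b j / T + P.a i) Filter.atTop (𝓝 (P.a i)) := by
      simpa using (Filter.Tendsto.div_atTop (tendsto_const_nhds (x := P.b j))
        Filter.tendsto_id).add_const (P.a i)
    have h2 := (((Real.continuousAt_log ha.ne').tendsto.comp h1).sub_const
      (Real.log (P.b j))).const_mul (P.overlap i j * P.a i)
    refine h2.congr' ?_
    filter_upwards [Filter.eventually_gt_atTop 0] with T hT
    have h3 : P.b j + T * P.a i = T * (P.b j / T + P.a i) := by field_simp
    have h4 : 0 < P.b j / T + P.a i := by have := div_nonneg (P.b_nonneg j) hT.le; linarith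
    rw [h3, Real.log_mul hT.ne' h4.ne', Function.comp_apply]
    ring

/-- Joint subadditivity (equivalently, joint convexity) of the relative entropy. Being a maximum of
linear functionals, `resolvent` is subadditive; integrating gives the same for `truncated`, and
`T → ∞` for the relative entropy. -/
theorem relEntropy_le_sum {K : Type*} [Fintype K] (Q : K → SpectralPair S)
    (hl : P.left = ∑ k, (Q k).left) (hr : P.right = ∑ k, (Q k).right) :
    P.relEntropy ≤ ∑ k, (Q k).relEntropy := by
  have hres : ∀ t, 0 < t → P.resolvent t ≤ ∑ k, (Q k).resolvent t := by
    intro t ht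
    obtain ⟨Z, hZ⟩ := P.exists_dualForm_eq_resolvent ht
    rw [← hZ, hl, hr, dualForm_sum]
    exact Finset.sum_le_sum fun k _ => (Q k).dualForm_le_resolvent ht Z
  have hder : ∀ T, 0 ≤ T → HasDerivAt (fun T => ∑ k, (Q k).truncated T - P.truncated T)
      (∑ k, (Q k).resolvent T - P.resolvent T) T := fun T hT =>
    (HasDerivAt.fun_sum fun k _ => (Q k).hasDerivAt_truncated hT).sub (P.hasDerivAt_truncated hT)
  have hmono : MonotoneOn (fun T => ∑ k, (Q k).truncated T - P.truncated T) (Set.Ici 0) := by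
    refine monotoneOn_of_deriv_nonneg (convex_Ici 0)
      (fun T hT => (hder T hT).continuousAt.continuousWithinAt)
      (fun T hT => (hder T ?_).differentiableAt.differentiableWithinAt) fun T hT => ?_
    · rw [interior_Ici] at hT; exact le_of_lt hT
    · rw [interior_Ici] at hT
      rw [(hder T (le_of_lt hT)).deriv]
      exact sub_nonneg.2 (hres T hT)
  have hle : ∀ T, 0 ≤ T → P.truncated T ≤ ∑ k, (Q k).truncated T := by
    intro T hT
    have := hmono (Set.mem_Ici.2 le_rfl) (Set.mem_Ici.2 hT) hT
    simpa [truncated_zero] using this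
  have hlim := tendsto_finsetSum Finset.univ fun k (_ : k ∈ Finset.univ) => (Q k).tendsto_truncated
  refine le_of_tendsto_of_tendsto P.tendsto_truncated hlim ?_
  filter_upwards [Filter.eventually_ge_atTop 0] with T hT
  rw [Finset.sum_sub_distrib, ← Finset.sum_mul, ← Complex.re_sum, ← Matrix.trace_sum, ← hl]
  exact sub_le_sub_right (hle T hT) _

end SpectralPair

end RelativeEntropy

/-! ### Conditional entropy of separable states -/

section Separable

variable {S A B : Type*} [Fintype S] [DecidableEq S] [Fintype A] [DecidableEq A]
  [Fintype B] [DecidableEq B]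

/-- The sums `∑ᵢ |⟨uᵢ, wⱼ⟩|² aᵢ` are the diagonal entries of `∑ᵢ aᵢ |uᵢ⟩⟨uᵢ|` in the basis
`w`. -/
theorem sum_normSq_mul_eq (U W : Matrix S S ℂ) (a : S → ℝ) (j : S) :
    ∑ i, Complex.normSq ((Uᴴ * W) i j) * a i =
      ((Wᴴ * (U * Matrix.diagonal (fun i => (a i : ℂ)) * Uᴴ) * W) j j).re := by
  have h : Wᴴ * (U * Matrix.diagonal (fun i => (a i : ℂ)) * Uᴴ) * W =
      (Uᴴ * W)ᴴ * (Matrix.diagonal (fun i => (a i : ℂ)) * (Uᴴ * W)) := by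
    simp only [Matrix.conjTranspose_mul, Matrix.conjTranspose_conjTranspose, mul_assoc]
  rw [h, Matrix.mul_apply, Complex.re_sum]
  refine Finset.sum_congr rfl fun i _ => ?_
  rw [Matrix.diagonal_mul, Matrix.conjTranspose_apply]
  simp only [Complex.normSq_apply, Complex.star_def, Complex.mul_re, Complex.mul_im,
      Complex.conj_re, Complex.conj_im, Complex.ofReal_re, Complex.ofReal_im]
  ring

theorem mul_log_eq (x : ℝ) : x * Real.log x = -(Real.log 2 * eta x) := by
  have : Real.log 2 ≠ 0 := (Real.log_pos (by norm_num)).ne'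
  rw [eta, Real.logb]; field_simp

theorem SpectralPair.relEntropy_eq (P : SpectralPair S) :
    P.relEntropy = -(Real.log 2 * entropy P.left) -
      ∑ j, ((P.Wᴴ * P.left * P.W) j j).re * Real.log (P.b j) := by
  have hrow : ∀ i, ∑ j, P.overlap i j = 1 := P.sum_overlap
  have h1 : P.relEntropy = ∑ i, (∑ j, P.overlap i j) * (P.a i * Real.log (P.a i)) -
      ∑ j, (∑ i, P.overlap i j * P.a i) * Real.log (P.b j) := by
    simp only [Finset.sum_mul]
    rw [Finset.sum_comm (s := Finset.univ) (t := Finset.univ)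
      (f := fun j i => P.overlap i j * P.a i * Real.log (P.b j))]
    simp only [← Finset.sum_sub_distrib, SpectralPair.relEntropy]
    refine Finset.sum_congr rfl fun i _ => Finset.sum_congr rfl fun j _ => ?_
    ring
  rw [h1]
  congr 1
  · rw [SpectralPair.left, entropy_unitary_diagonal P.U_mem]
    simp only [hrow, one_mul, mul_log_eq, Finset.mul_sum, Finset.sum_neg_distrib]
  · refine Finset.sum_congr rfl fun j _ => ?_
    rw [SpectralPair.left, ← sum_normSq_mul_eq]
    rfl

/-- For a separable state `∑ₖ ρₖ ⊗ Nₖ` of `AB`, the conditional entropy `H(B|A)` is at least the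
conditional entropy of `B` given `k`. This is strong subadditivity for states that are prepared from
a classical register; it is the joint subadditivity of the relative entropy for the pairs
`(ρₖ ⊗ Nₖ, tr Nₖ ρₖ ⊗ 1)`. -/
theorem entropy_add_sum_le_entropy_sum_kronecker {K : Type*} [Fintype K] {ρ : K → Matrix A A ℂ}
    (hρ : ∀ k, IsDensity (ρ k)) {N : K → Matrix B B ℂ} (hN : ∀ k, (N k).PosSemidef) :
    entropy (∑ k, ((N k).trace.re : ℂ) • ρ k) + ∑ k, (entropy (N k) - eta (N k).trace.re) ≤
      entropy (∑ k, ρ k ⊗ₖ N k) := by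
  choose R hR hρR using fun k => exists_unitary_diagonal (hρ k).1.isHermitian
  choose O hO hNO using fun k => exists_unitary_diagonal (hN k).isHermitian
  obtain ⟨M, hMdef⟩ : ∃ M, M = ∑ k, ρ k ⊗ₖ N k := ⟨_, rfl⟩
  obtain ⟨L, hLdef⟩ : ∃ L, L = ∑ k, ((N k).trace.re : ℂ) • ρ k := ⟨_, rfl⟩
  rw [← hMdef, ← hLdef]
  have hM : M.PosSemidef := hMdef ▸ Matrix.posSemidef_sum _ fun k _ => (hρ k).1.kronecker (hN k)
  have htr : ∀ k, 0 ≤ (N k).trace.re := fun k => by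
    have := (hN k).trace_nonneg
    exact (Complex.le_def.1 this).1
  have hL : L.PosSemidef := hLdef ▸
    Matrix.posSemidef_sum _ fun k _ => (hρ k).1.smul (by exact_mod_cast htr k)
  obtain ⟨U, hU, hMU⟩ := exists_unitary_diagonal hM.isHermitian
  obtain ⟨V, hV, hLV⟩ := exists_unitary_diagonal hL.isHermitian
  set r := fun k => (hρ k).1.isHermitian.eigenvalues with hr
  set s := fun k => (hN k).isHermitian.eigenvalues with hs
  have hr0 : ∀ k i, 0 ≤ r k i := fun k => (hρ k).1.eigenvalues_nonneg
  have hs0 : ∀ k i, 0 ≤ s k i := fun k => (hN k).eigenvalues_nonneg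
  have hl0 : ∀ i, 0 ≤ hL.isHermitian.eigenvalues i := hL.eigenvalues_nonneg
  have hrsum : ∀ k, ∑ i, r k i = 1 := fun k => by
    have h := (hρ k).2
    rw [(hρ k).1.isHermitian.trace_eq_sum_eigenvalues] at h
    have h' : ((∑ i, r k i : ℝ) : ℂ) = 1 := by rw [← h]; simp [r]
    exact_mod_cast h'
  have hssum : ∀ k, ∑ i, s k i = (N k).trace.re := fun k => by
    rw [(hN k).isHermitian.trace_eq_sum_eigenvalues]; simp [hs]
  -- in the eigenbasis of the marginal `L`, the diagonal of `M` has the spectrum of `L` as marginal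
  have hdiag : ∀ i,
      ∑ j, (((V ⊗ₖ (1 : Matrix B B ℂ))ᴴ * M * (V ⊗ₖ (1 : Matrix B B ℂ))) (i, j) (i, j)).re
      = hL.isHermitian.eigenvalues i := by
    intro i
    have hV' : Vᴴ * V = 1 := (Matrix.mem_unitaryGroup_iff').1 hV
    have h1 : Vᴴ * L * V = Matrix.diagonal fun i => (hL.isHermitian.eigenvalues i : ℂ) := by
      conv_lhs => rw [hLV]
      calc _ = (Vᴴ * V) * Matrix.diagonal (fun i => (hL.isHermitian.eigenvalues i : ℂ)) *
            (Vᴴ * V) := by simp only [mul_assoc]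
        _ = _ := by rw [hV', one_mul, mul_one]
    have h2 : ∀ j, ((V ⊗ₖ (1 : Matrix B B ℂ))ᴴ * M * (V ⊗ₖ (1 : Matrix B B ℂ))) (i, j) (i, j) =
        ∑ k, (Vᴴ * ρ k * V) i i * N k j j := by
      intro j
      rw [hMdef, Matrix.mul_sum, Matrix.sum_mul, Matrix.sum_apply]
      refine Finset.sum_congr rfl fun k _ => ?_
      rw [Matrix.conjTranspose_kronecker, ← Matrix.mul_kronecker_mul, ← Matrix.mul_kronecker_mul]
      simp
    rw [← Complex.re_sum]
    simp only [h2]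
    rw [Finset.sum_comm]
    have h3 : ∑ k, ∑ j, (Vᴴ * ρ k * V) i i * N k j j = (Vᴴ * L * V) i i := by
      rw [hLdef, Matrix.mul_sum, Matrix.sum_mul, Matrix.sum_apply]
      refine Finset.sum_congr rfl fun k _ => ?_
      rw [← Finset.mul_sum, Matrix.mul_smul, Matrix.smul_mul, Matrix.smul_apply, smul_eq_mul,
        ← trace_eq_re (hN k).isHermitian, mul_comm]
      rfl
    rw [h3, h1]; simp
  have hunit : V ⊗ₖ (1 : Matrix B B ℂ) ∈ Matrix.unitaryGroup (A × B) ℂ :=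
    Matrix.kronecker_mem_unitary hV (one_mem _)
  let P : SpectralPair (A × B) :=
    { U := U
      W := V ⊗ₖ (1 : Matrix B B ℂ)
      a := hM.isHermitian.eigenvalues
      b := fun j => hL.isHermitian.eigenvalues j.1
      U_mem := hU
      W_mem := hunit
      a_nonneg := hM.eigenvalues_nonneg
      b_nonneg := fun j => hl0 j.1
      support := by
        rintro i ⟨j, j'⟩ hj
        have h0 := hdiag j
        rw [hj] at h0
        have hnn : ∀ i j, 0 ≤ Complex.normSq ((Uᴴ * (V ⊗ₖ (1 : Matrix B B ℂ))) i j) *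
            hM.isHermitian.eigenvalues i :=
          fun i j => mul_nonneg (Complex.normSq_nonneg _) (hM.eigenvalues_nonneg i)
        rw [hMU] at h0
        simp only [← sum_normSq_mul_eq] at h0
        have h1 := (Finset.sum_eq_zero_iff_of_nonneg
          (fun j' _ => Finset.sum_nonneg fun i _ => hnn i (j, j'))).1 h0 j' (Finset.mem_univ _)
        exact (Finset.sum_eq_zero_iff_of_nonneg
          (fun i _ => hnn i (j, j'))).1 h1 i (Finset.mem_univ _) }
  have hUW : ∀ k, (R k ⊗ₖ O k)ᴴ * (R k ⊗ₖ O k) = 1 := fun k =>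
    (Matrix.mem_unitaryGroup_iff').1 (Matrix.kronecker_mem_unitary (hR k) (hO k))
  let Q : K → SpectralPair (A × B) := fun k =>
    { U := R k ⊗ₖ O k
      W := R k ⊗ₖ O k
      a := fun i => r k i.1 * s k i.2
      b := fun i => (N k).trace.re * r k i.1
      U_mem := Matrix.kronecker_mem_unitary (hR k) (hO k)
      W_mem := Matrix.kronecker_mem_unitary (hR k) (hO k)
      a_nonneg := fun i => mul_nonneg (hr0 _ _) (hs0 _ _)
      b_nonneg := fun i => mul_nonneg (htr k) (hr0 _ _)
      support := by
        rintro i j hj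
        rw [hUW, Matrix.one_apply]
        split_ifs with hij
        · subst hij
          rcases mul_eq_zero.1 hj with h | h
          · rw [← hssum] at h
            have := (Finset.sum_eq_zero_iff_of_nonneg (fun i _ => hs0 k i)).1 h i.2
              (Finset.mem_univ _)
            simp [this]
          · simp [h]
        · simp }
  have hPl : P.left = M := hMU.symm
  have hPr : P.right = L ⊗ₖ (1 : Matrix B B ℂ) := by
    conv_rhs => rw [hLV]
    have h1 : (1 : Matrix B B ℂ) = 1 * 1 * 1ᴴ := by simp
    conv_rhs => rw [h1]
    rw [Matrix.mul_kronecker_mul, Matrix.mul_kronecker_mul, ← Matrix.conjTranspose_kronecker]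
    change _ * _ * _ = _
    congr 2
    rw [← Matrix.diagonal_one, Matrix.diagonal_kronecker_diagonal]
    simp [P]
  have hQl : ∀ k, (Q k).left = ρ k ⊗ₖ N k := by
    intro k
    conv_rhs => rw [hρR k, hNO k]
    rw [Matrix.mul_kronecker_mul, Matrix.mul_kronecker_mul, ← Matrix.conjTranspose_kronecker,
      Matrix.diagonal_kronecker_diagonal]
    simp [SpectralPair.left, Q, r, s]
  have hQr : ∀ k, (Q k).right = (((N k).trace.re : ℂ) • ρ k) ⊗ₖ (1 : Matrix B B ℂ) := by
    intro k
    have h1 : (1 : Matrix B B ℂ) = O k * Matrix.diagonal (fun _ => (1 : ℂ)) * (O k)ᴴ := by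
      rw [Matrix.diagonal_one, mul_one]; exact ((Matrix.mem_unitaryGroup_iff).1 (hO k)).symm
    have h2 : ((N k).trace.re : ℂ) • ρ k = R k * Matrix.diagonal
        (fun i => (N k).trace.re * (r k i : ℂ)) * (R k)ᴴ := by
      conv_lhs => rw [hρR k]
      rw [← Matrix.smul_mul, ← Matrix.mul_smul, ← Matrix.diagonal_smul]
      rfl
    conv_rhs => rw [h1, h2]
    rw [Matrix.mul_kronecker_mul, Matrix.mul_kronecker_mul, ← Matrix.conjTranspose_kronecker,
      Matrix.diagonal_kronecker_diagonal]
    simp [SpectralPair.right, Q]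
  have hkron : ∀ X : K → Matrix A A ℂ,
      (∑ k, X k) ⊗ₖ (1 : Matrix B B ℂ) = ∑ k, X k ⊗ₖ (1 : Matrix B B ℂ) := by
    intro X; ext i j
    simp [Matrix.sum_apply, Finset.sum_mul]
  have hmain := P.relEntropy_le_sum Q (by rw [hPl, hMdef]; simp only [hQl])
    (by rw [hPr, hLdef, hkron]; simp only [hQr])
  have hPval : P.relEntropy = Real.log 2 * (entropy L - entropy M) := by
    rw [P.relEntropy_eq, hPl]
    -- the eigenvalues of `L ⊗ 1` do not depend on the second index, which is summed out
    have : ∑ j, ((P.Wᴴ * M * P.W) j j).re * Real.log (P.b j) = -(Real.log 2 * entropy L) := by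
      rw [Fintype.sum_prod_type, entropy_eq_sum_eigenvalues hL.isHermitian, Finset.mul_sum,
        ← Finset.sum_neg_distrib]
      refine Finset.sum_congr rfl fun i _ => ?_
      rw [← mul_log_eq]
      change ∑ j, _ * Real.log (hL.isHermitian.eigenvalues i) = _
      rw [← Finset.sum_mul]
      congr 1
      exact hdiag i
    rw [this]; ring
  have hQval : ∀ k, (Q k).relEntropy =
      -(Real.log 2 * (entropy (N k) - eta (N k).trace.re)) := by
    intro k
    have h1 : (Q k).relEntropy = ∑ i, r k i * ∑ j, (s k j * Real.log (s k j) -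
        s k j * Real.log ((N k).trace.re)) := by
      simp only [SpectralPair.relEntropy, SpectralPair.overlap, Q, hUW, Matrix.one_apply]
      rw [Fintype.sum_prod_type]
      refine Finset.sum_congr rfl fun i _ => ?_
      rw [Finset.mul_sum]
      refine Finset.sum_congr rfl fun j _ => ?_
      rw [Finset.sum_eq_single (i, j)]
      · rw [if_pos rfl, map_one, one_mul]
        rcases eq_or_ne (r k i) 0 with h | h
        · simp [h]
        rcases eq_or_ne (s k j) 0 with h' | h'
        · simp [h']
        have ht : (N k).trace.re ≠ 0 := by
          intro h0
          rw [← hssum] at h0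
          exact h' ((Finset.sum_eq_zero_iff_of_nonneg (fun i _ => hs0 k i)).1 h0 j
            (Finset.mem_univ _))
        rw [Real.log_mul h h', Real.log_mul ht h]
        ring
      · intro b _ hb
        rw [if_neg (Ne.symm hb)]; simp
      · simp
    rw [h1, ← Finset.sum_mul, hrsum, one_mul, Finset.sum_sub_distrib, ← Finset.sum_mul, hssum,
      mul_log_eq, entropy_eq_sum_eigenvalues (hN k).isHermitian]
    simp only [mul_log_eq, Finset.sum_neg_distrib, ← Finset.mul_sum]
    ring
  simp only [hQval] at hmain
  rw [hPval, Finset.sum_neg_distrib, ← Finset.mul_sum, ← mul_neg] at hmain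
  have := le_of_mul_le_mul_left hmain (Real.log_pos (by norm_num))
  linarith

end Separable

/-! ### Informations of channels and measurements -/

section Information

variable {S T X B E Y : Type*} [Fintype S] [DecidableEq S] [Fintype T] [DecidableEq T]
  [Fintype X] [DecidableEq X]
  [Fintype B] [DecidableEq B] [Fintype E] [DecidableEq E] [Fintype Y] [DecidableEq Y]

/-- The entropy of an unnormalized state, made homogeneous: `t` times the entropy of the
normalized state, for a state of trace `t`. -/
noncomputable def homEntropy (M : Matrix S S ℂ) : ℝ := entropy M - eta M.trace.re

/-- The Shannon entropy of an unnormalized distribution, made homogeneous. -/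
noncomputable def homShannon (w : X → ℝ) : ℝ := ∑ x, eta (w x) - eta (∑ x, w x)

/-- `I(Y;X)` for the input distribution `p` and the channel `Q`. -/
noncomputable def inputInfo (p : X → ℝ) (Q : X → Y → ℝ) : ℝ :=
  ∑ x, eta (p x) - ∑ y, homShannon fun x => p x * Q x y

/-- The unnormalized state of `B` conditional on the output `y` of the channel `Q`. -/
noncomputable def condState (p : X → ℝ) (ρ : X → Matrix B B ℂ) (Q : X → Y → ℝ) (y : Y) :
    Matrix B B ℂ :=
  ∑ x, ((p x * Q x y : ℝ) : ℂ) • ρ x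

/-- `I(Y;B)` for the ensemble `(p, ρ)` and the channel `Q`. -/
noncomputable def outputInfo (p : X → ℝ) (ρ : X → Matrix B B ℂ) (Q : X → Y → ℝ) : ℝ :=
  entropy (∑ x, (p x : ℂ) • ρ x) - ∑ y, homEntropy (condState p ρ Q y)

/-- Holevo information of the ensemble of unnormalized states `M y`. -/
theorem mutualInfo_sum_single_kronecker {M : Y → Matrix S S ℂ} (hM : ∀ y, (M y).IsHermitian) :
    mutualInfo (∑ y, Matrix.single y y (1 : ℂ) ⊗ₖ M y) =
      entropy (∑ y, M y) - ∑ y, homEntropy (M y) := by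
  have h1 : traceRight (∑ y, Matrix.single y y (1 : ℂ) ⊗ₖ M y) =
      Matrix.diagonal fun y => (((M y).trace.re : ℝ) : ℂ) := by
    ext y y'
    simp only [traceRight, Matrix.of_apply, sum_single_kronecker_apply, Matrix.diagonal_apply]
    split_ifs with h
    · rw [← trace_eq_re (hM y)]; rfl
    · simp
  have h2 : traceLeft (∑ y, Matrix.single y y (1 : ℂ) ⊗ₖ M y) = ∑ y, M y := by
    ext t t'
    rw [Matrix.sum_apply]
    exact Finset.sum_congr rfl fun y _ => by rw [sum_single_kronecker_apply, if_pos rfl]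
  rw [mutualInfo, h1, h2, entropy_diagonal, entropy_sum_single_kronecker hM]
  simp only [homEntropy, Finset.sum_sub_distrib]
  ring

omit [DecidableEq X] in
theorem traceLeft_kronecker_mul_apply (L : Matrix X X ℂ) (τ : Matrix (X × S) (X × S) ℂ) (t t' : S) :
    traceLeft ((L ⊗ₖ (1 : Matrix S S ℂ)) * τ) t t' =
      ∑ x, ∑ x', L x x' * τ (x', t) (x, t') := by
  simp only [traceLeft, Matrix.of_apply, Matrix.mul_apply, Fintype.sum_prod_type,
    Matrix.kroneckerMap_apply, Matrix.one_apply]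
  refine Finset.sum_congr rfl fun x _ => Finset.sum_congr rfl fun x' _ => ?_
  simp

omit [DecidableEq X] in
theorem traceE_measured (L : Y → Matrix X X ℂ) (τ : Matrix (X × B × E) (X × B × E) ℂ) :
    traceE (measured L τ) = measured L (traceE τ) := by
  ext ⟨y, b⟩ ⟨y', b'⟩
  simp only [traceE, traceRight, measured, Matrix.of_apply, Matrix.reindex_apply,
    Matrix.submatrix_apply, Equiv.symm_symm, Equiv.prodAssoc_apply, sum_single_kronecker_apply,
    traceLeft_kronecker_mul_apply]
  split_ifs with h
  · rw [Finset.sum_comm]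
    refine Finset.sum_congr rfl fun x _ => ?_
    rw [Finset.sum_comm]
    simp only [Finset.mul_sum]
  · simp

omit [Fintype B] [DecidableEq B] in
theorem cqState_apply (p : X → ℝ) (ρ : X → Matrix B B ℂ) (i j : X × B) :
    cqState p ρ i j = if i.1 = j.1 then (p i.1 : ℂ) * ρ i.1 i.2 j.2 else 0 := by
  have : cqState p ρ = ∑ x, Matrix.single x x (1 : ℂ) ⊗ₖ ((p x : ℂ) • ρ x) := by
    simp [cqState, Matrix.kronecker_smul]
  rw [this, sum_single_kronecker_apply]; rfl

theorem traceLeft_mul_cqState (L : Matrix X X ℂ) (p : X → ℝ) (ρ : X → Matrix B B ℂ) :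
    traceLeft ((L ⊗ₖ (1 : Matrix B B ℂ)) * cqState p ρ) = ∑ x, (p x * L x x) • ρ x := by
  ext b b'
  rw [traceLeft_kronecker_mul_apply, Matrix.sum_apply]
  refine Finset.sum_congr rfl fun x _ => ?_
  rw [Finset.sum_eq_single x]
  · simp [cqState_apply]; ring
  · intro x' _ hx; simp [cqState_apply, hx]
  · simp

variable {p : X → ℝ} {ρ : X → Matrix B B ℂ}

omit [DecidableEq X] [DecidableEq B] in
theorem isHermitian_smul_sum (hρ : ∀ x, IsDensity (ρ x)) (c : X → ℝ) :
    (∑ x, (c x : ℂ) • ρ x).IsHermitian := by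
  rw [Matrix.IsHermitian, Matrix.conjTranspose_sum]
  refine Finset.sum_congr rfl fun x _ => ?_
  rw [Matrix.conjTranspose_smul, (hρ x).1.isHermitian]
  simp

theorem mutualInfo_measured_cqState (hρ : ∀ x, IsDensity (ρ x)) {L : Y → Matrix X X ℂ}
    (hL : IsPOVM L) :
    mutualInfo (measured L (cqState p ρ)) = outputInfo p ρ fun x y => (L y x x).re := by
  have hre : ∀ y x, L y x x = ((L y x x).re : ℂ) := fun y x =>
    (Complex.conj_eq_iff_re.1 ((hL.1 y).isHermitian.apply x x)).symm
  have hM : ∀ y, traceLeft ((L y ⊗ₖ (1 : Matrix B B ℂ)) * cqState p ρ) =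
      condState p ρ (fun x y => (L y x x).re) y := by
    intro y
    rw [traceLeft_mul_cqState, condState]
    refine Finset.sum_congr rfl fun x _ => ?_
    conv_lhs => rw [hre]
    push_cast; rfl
  have hsum : ∑ y, condState p ρ (fun x y => (L y x x).re) y = ∑ x, (p x : ℂ) • ρ x := by
    simp only [condState]
    rw [Finset.sum_comm]
    refine Finset.sum_congr rfl fun x _ => ?_
    rw [← Finset.sum_smul]
    congr 1
    have := congrFun (congrFun hL.2 x) x
    rw [Matrix.sum_apply, Matrix.one_apply_eq] at this
    push_cast
    rw [← Finset.mul_sum]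
    simp only [← hre, this, mul_one]
  rw [measured]
  simp only [hM]
  rw [mutualInfo_sum_single_kronecker (M := condState p ρ fun x y => (L y x x).re)
    fun y => isHermitian_smul_sum hρ _, hsum]
  rfl

omit [Fintype X] [DecidableEq Y] in
theorem isPOVM_channelPOVM {Q : X → Y → ℝ} (hQ : IsChannel Q) : IsPOVM (channelPOVM Q) := by
  constructor
  · intro y
    exact Matrix.PosSemidef.diagonal fun x => by
      simpa using (hQ x).1 y
  · ext x x'
    rw [Matrix.sum_apply]
    simp only [channelPOVM, Matrix.diagonal_apply, Matrix.one_apply]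
    split_ifs with h
    · rw [← Complex.ofReal_sum, (hQ x).2, Complex.ofReal_one]
    · simp

theorem mutualInfo_measured_channelPOVM (hρ : ∀ x, IsDensity (ρ x)) {Q : X → Y → ℝ}
    (hQ : IsChannel Q) :
    mutualInfo (measured (channelPOVM Q) (cqState p ρ)) = outputInfo p ρ Q := by
  rw [mutualInfo_measured_cqState hρ (isPOVM_channelPOVM hQ)]
  simp [channelPOVM]

variable {ψ : X × B × E → ℂ}

/-- `I(Y;B)` depends on the diagonal of the measurement only. -/
theorem infoYB_eq {m : ℕ} (hρ : ∀ x, IsDensity (ρ x)) (hψ : IsPurification ψ (cqState p ρ))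
    {L : Fin m → Matrix X X ℂ} (hL : IsPOVM L) :
    infoYB L ψ = outputInfo p ρ fun x y => (L y x x).re := by
  rw [infoYB, traceE_measured, hψ, mutualInfo_measured_cqState hρ hL]

/-- The amplitudes of `ψ`, as a matrix from `X` to `BE`. -/
def amplitude (ψ : X × B × E → ℂ) : Matrix (B × E) X ℂ := Matrix.of fun t x => ψ (x, t)

omit [DecidableEq B] [DecidableEq E] in
theorem amplitude_conjTranspose_mul (hρ : ∀ x, IsDensity (ρ x))
    (hψ : IsPurification ψ (cqState p ρ)) :
    (amplitude ψ)ᴴ * amplitude ψ = Matrix.diagonal fun x => (p x : ℂ) := by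
  have h : ∀ x x' b b', ∑ e, ψ (x, b, e) * star (ψ (x', b', e)) =
      if x = x' then (p x : ℂ) * ρ x b b' else 0 := by
    intro x x' b b'
    have := congrFun (congrFun hψ (x, b)) (x', b')
    rw [cqState_apply] at this
    exact this
  ext x x'
  simp only [Matrix.mul_apply, Matrix.conjTranspose_apply, amplitude, Matrix.of_apply,
    Fintype.sum_prod_type]
  have h1 : ∀ b, ∑ e, star (ψ (x, b, e)) * ψ (x', b, e) =
      if x' = x then (p x' : ℂ) * ρ x' b b else 0 := by
    intro b
    rw [← h]
    exact Finset.sum_congr rfl fun e _ => mul_comm _ _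
  simp only [h1, Matrix.diagonal_apply]
  by_cases hx : x = x'
  · subst hx
    have := (hρ x).2
    simp only [if_true, ← Finset.mul_sum]
    rw [show ∑ b, ρ x b b = 1 from this, mul_one]
  · simp [hx, Ne.symm hx]

omit [DecidableEq X] in
theorem traceLeft_mul_pureState (L : Matrix X X ℂ) :
    traceLeft ((L ⊗ₖ (1 : Matrix (B × E) (B × E) ℂ)) * pureState ψ) =
      amplitude ψ * Lᵀ * (amplitude ψ)ᴴ := by
  ext t t'
  rw [traceLeft_kronecker_mul_apply, Matrix.mul_apply]
  refine Finset.sum_congr rfl fun x _ => ?_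
  rw [Matrix.mul_apply, Finset.sum_mul]
  refine Finset.sum_congr rfl fun x' _ => ?_
  simp only [pureState, Matrix.vecMulVec_apply, amplitude, Matrix.of_apply, Matrix.transpose_apply,
    Matrix.conjTranspose_apply, Pi.star_apply]
  ring

/-- The state of `BE` after an outcome of a measurement of `X` has the same nonzero spectrum as the
corresponding state of `X`. -/
theorem entropy_amplitude_mul (hp : ∀ x, 0 ≤ p x) (hρ : ∀ x, IsDensity (ρ x))
    (hψ : IsPurification ψ (cqState p ρ)) {L : Matrix X X ℂ} (hL : L.PosSemidef) :
    entropy (amplitude ψ * L * (amplitude ψ)ᴴ) =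
      entropy (Matrix.diagonal (fun x => (√(p x) : ℂ)) * L *
        Matrix.diagonal fun x => (√(p x) : ℂ)) := by
  obtain ⟨C, rfl⟩ : ∃ C : Matrix X X ℂ, L = Cᴴ * C := by
    open scoped MatrixOrder in
    exact CStarAlgebra.nonneg_iff_eq_star_mul_self.mp hL.nonneg
  set G := amplitude ψ with hG
  set D : Matrix X X ℂ := Matrix.diagonal fun x => (√(p x) : ℂ) with hD
  have hDD : Gᴴ * G = D * D := by
    rw [amplitude_conjTranspose_mul hρ hψ, hD, Matrix.diagonal_mul_diagonal]
    congr 1; funext x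
    rw [← Complex.ofReal_mul, Real.mul_self_sqrt (hp x)]
  have hDH : Dᴴ = D := by
    simp [hD, Matrix.diagonal_conjTranspose, Pi.star_def]
  have h1 : G * (Cᴴ * C) * Gᴴ = (C * Gᴴ)ᴴ * (C * Gᴴ) := by
    simp only [Matrix.conjTranspose_mul, Matrix.conjTranspose_conjTranspose, Matrix.mul_assoc]
  have h2 : (C * Gᴴ) * (C * Gᴴ)ᴴ = (C * D) * (C * D)ᴴ := by
    simp only [Matrix.conjTranspose_mul, Matrix.conjTranspose_conjTranspose, Matrix.mul_assoc, hDH]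
    rw [← Matrix.mul_assoc Gᴴ, hDD, Matrix.mul_assoc]
  have h3 : (C * D)ᴴ * (C * D) = D * (Cᴴ * C) * D := by
    simp only [Matrix.conjTranspose_mul, Matrix.mul_assoc, hDH]
  -- `G Cᴴ C Gᴴ`, `C D D Cᴴ` and `D Cᴴ C D` have the same nonzero spectrum
  rw [h1, ← h3, entropy_mul_comm (Matrix.isHermitian_conjTranspose_mul_self _)
    (Matrix.isHermitian_mul_conjTranspose_self _), h2,
    entropy_mul_comm (Matrix.isHermitian_mul_conjTranspose_self _)
    (Matrix.isHermitian_conjTranspose_mul_self _)]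

/-- `I(Y;BE)` expressed through the post-measurement states of `X`, since `BE` purifies `X`. -/
theorem infoYBE_eq {m : ℕ} (hp : ∀ x, 0 ≤ p x) (hρ : ∀ x, IsDensity (ρ x))
    (hψ : IsPurification ψ (cqState p ρ)) {L : Fin m → Matrix X X ℂ} (hL : IsPOVM L) :
    infoYBE L ψ = ∑ x, eta (p x) -
      ∑ y, (entropy (Matrix.diagonal (fun x => (√(p x) : ℂ)) * (L y)ᵀ *
        Matrix.diagonal fun x => (√(p x) : ℂ)) - eta (∑ x, p x * (L y x x).re)) := by
  have hre : ∀ y x, L y x x = ((L y x x).re : ℂ) := fun y x =>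
    (Complex.conj_eq_iff_re.1 ((hL.1 y).isHermitian.apply x x)).symm
  have hsum : ∑ y, amplitude ψ * (L y)ᵀ * (amplitude ψ)ᴴ =
      amplitude ψ * (1 : Matrix X X ℂ) * (amplitude ψ)ᴴ := by
    rw [← Matrix.sum_mul, ← Matrix.mul_sum, ← Matrix.transpose_sum, hL.2, Matrix.transpose_one]
  have htr : ∀ y, (amplitude ψ * (L y)ᵀ * (amplitude ψ)ᴴ).trace.re =
      ∑ x, p x * (L y x x).re := by
    intro y
    rw [Matrix.trace_mul_comm, ← Matrix.mul_assoc, amplitude_conjTranspose_mul hρ hψ,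
      Matrix.trace, Complex.re_sum]
    refine Finset.sum_congr rfl fun x _ => ?_
    simp [Matrix.diagonal_mul]
  change mutualInfo (measured L (pureState ψ)) = _
  rw [measured]
  simp only [traceLeft_mul_pureState]
  rw [mutualInfo_sum_single_kronecker fun y =>
    Matrix.isHermitian_mul_mul_conjTranspose _ (hL.1 y).isHermitian.transpose, hsum,
    entropy_amplitude_mul hp hρ hψ Matrix.PosSemidef.one]
  congr 1
  · rw [mul_one, Matrix.diagonal_mul_diagonal, ← entropy_diagonal]
    congr 2; funext x
    rw [← Complex.ofReal_mul, Real.mul_self_sqrt (hp x)]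
  · refine Finset.sum_congr rfl fun y _ => ?_
    rw [homEntropy, htr, entropy_amplitude_mul hp hρ hψ (hL.1 y).transpose]

/-- For a channel, `I(Y;BE) = I(Y;X)`. -/
theorem infoYBE_channelPOVM {m : ℕ} (hp : ∀ x, 0 ≤ p x) (hρ : ∀ x, IsDensity (ρ x))
    (hψ : IsPurification ψ (cqState p ρ)) {Q : X → Fin m → ℝ} (hQ : IsChannel Q) :
    infoYBE (channelPOVM Q) ψ = inputInfo p Q := by
  rw [infoYBE_eq hp hρ hψ (isPOVM_channelPOVM hQ), inputInfo]
  congr 1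
  refine Finset.sum_congr rfl fun y _ => ?_
  rw [homShannon, ← entropy_diagonal]
  congr 2
  · rw [channelPOVM, Matrix.diagonal_transpose, Matrix.diagonal_mul_diagonal,
      Matrix.diagonal_mul_diagonal]
    congr 1; funext x
    rw [mul_right_comm, ← Complex.ofReal_mul, Real.mul_self_sqrt (hp x), Complex.ofReal_mul]
  · simp [channelPOVM]

/-- Dephasing a measurement does not increase `I(Y;BE)`. -/
theorem inputInfo_le_infoYBE {m : ℕ} (hp : ∀ x, 0 ≤ p x) (hρ : ∀ x, IsDensity (ρ x))
    (hψ : IsPurification ψ (cqState p ρ)) {L : Fin m → Matrix X X ℂ} (hL : IsPOVM L) :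
    inputInfo p (fun x y => (L y x x).re) ≤ infoYBE L ψ := by
  rw [infoYBE_eq hp hρ hψ hL, inputInfo]
  refine sub_le_sub_left (Finset.sum_le_sum fun y _ => sub_le_sub_right ?_ _) _
  have hD : (Matrix.diagonal fun x => (√(p x) : ℂ))ᴴ = Matrix.diagonal fun x => (√(p x) : ℂ) := by
    simp [Matrix.diagonal_conjTranspose, Pi.star_def]
  have hpos : (Matrix.diagonal (fun x => (√(p x) : ℂ)) * (L y)ᵀ *
        Matrix.diagonal fun x => (√(p x) : ℂ)).PosSemidef := by
    have := (hL.1 y).transpose.mul_mul_conjTranspose_same (Matrix.diagonal fun x => (√(p x) : ℂ))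
    rwa [hD] at this
  refine (entropy_le_sum_diag hpos).trans_eq (Finset.sum_congr rfl fun x _ => ?_)
  rw [Matrix.mul_diagonal, Matrix.diagonal_mul, Matrix.transpose_apply, mul_right_comm,
    ← Complex.ofReal_mul, Real.mul_self_sqrt (hp x), Complex.re_ofReal_mul]

omit [Fintype X] [DecidableEq Y] in
theorem isChannel_diag {L : Y → Matrix X X ℂ} (hL : IsPOVM L) :
    IsChannel fun x y => (L y x x).re := by
  intro x
  refine ⟨fun y => ?_, ?_⟩
  · exact (Complex.le_def.1 ((hL.1 y).diag_nonneg (i := x))).1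
  · have := congrFun (congrFun hL.2 x) x
    rw [Matrix.sum_apply, Matrix.one_apply_eq] at this
    rw [← Complex.re_sum, this, Complex.one_re]

omit [DecidableEq B] in
theorem mutualInfo_jointYX (hρ : ∀ x, IsDensity (ρ x)) {Q : X → Y → ℝ}
    (hQ : IsChannel Q) : mutualInfo (jointYX Q (cqState p ρ)) = inputInfo p Q := by
  have h0 : ∀ x, traceRight (cqState p ρ) x x = (p x : ℂ) := by
    intro x
    simp only [traceRight, Matrix.of_apply, cqState_apply, if_true, ← Finset.mul_sum]
    rw [show ∑ b, ρ x b b = 1 from (hρ x).2, mul_one]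
  have h1 : jointYX Q (cqState p ρ) =
      Matrix.diagonal fun i : Y × X => ((p i.2 * Q i.2 i.1 : ℝ) : ℂ) := by
    rw [jointYX]; congr 1; funext i; rw [h0]; push_cast; ring
  have h2 : traceRight (jointYX Q (cqState p ρ)) =
      Matrix.diagonal fun y => ((∑ x, p x * Q x y : ℝ) : ℂ) := by
    rw [h1]; ext y y'
    simp only [traceRight, Matrix.of_apply, Matrix.diagonal_apply, Prod.mk.injEq, and_true]
    split_ifs <;> simp
  have h3 : traceLeft (jointYX Q (cqState p ρ)) = Matrix.diagonal fun x => ((p x : ℝ) : ℂ) := by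
    rw [h1]; ext x x'
    simp only [traceLeft, Matrix.of_apply, Matrix.diagonal_apply, Prod.mk.injEq, true_and]
    split_ifs
    · rw [← Complex.ofReal_sum, ← Finset.mul_sum, (hQ x).2, mul_one]
    · simp
  rw [mutualInfo, h2, h3, h1, entropy_diagonal, entropy_diagonal, entropy_diagonal, inputInfo]
  simp only [homShannon, Finset.sum_sub_distrib, Fintype.sum_prod_type]
  ring

/-! ### Independent copies -/

/-- The product distribution. -/
def powDist (n : ℕ) (p : X → ℝ) : (Fin n → X) → ℝ := fun x => ∏ k, p (x k)

/-- The product states. -/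
def powStates (n : ℕ) (ρ : X → Matrix B B ℂ) (x : Fin n → X) :
    Matrix (Fin n → B) (Fin n → B) ℂ :=
  Matrix.of fun b b' => ∏ k, ρ (x k) (b k) (b' k)

omit [Fintype B] [DecidableEq B] in
theorem statePow_cqState (n : ℕ) :
    statePow n (cqState p ρ) = cqState (powDist n p) (powStates n ρ) := by
  ext ⟨x, b⟩ ⟨x', b'⟩
  simp only [statePow, Matrix.of_apply, cqState_apply, powDist, powStates]
  split_ifs with h
  · subst h
    simp [Finset.prod_mul_distrib]
  · obtain ⟨k, hk⟩ := Function.ne_iff.1 h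
    exact Finset.prod_eq_zero (Finset.mem_univ k) (if_neg hk)

omit [Fintype B] [DecidableEq B] [DecidableEq E] in
theorem isPurification_vecPow (n : ℕ) (hψ : IsPurification ψ (cqState p ρ)) :
    IsPurification (vecPow n ψ) (cqState (powDist n p) (powStates n ρ)) := by
  rw [← statePow_cqState, ← hψ]
  ext ⟨x, b⟩ ⟨x', b'⟩
  change ∑ e : Fin n → E, (∏ k, ψ (x k, b k, e k)) * star (∏ k, ψ (x' k, b' k, e k)) =
    ∏ k, ∑ e, ψ (x k, b k, e) * star (ψ (x' k, b' k, e))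
  rw [Finset.prod_univ_sum, Fintype.piFinset_univ]
  refine Finset.sum_congr rfl fun e _ => ?_
  rw [star_prod, Finset.prod_mul_distrib]

end Information

/-! ### Bounded output alphabets and optimal channels -/

/-- Carathéodory's theorem for cones: a nonnegative combination of vectors can be rewritten using at
most as many of them as the dimension. -/
theorem exists_conic_reduction {Y V : Type*} [Fintype Y] [AddCommGroup V] [Module ℝ V]
    [FiniteDimensional ℝ V] (v : Y → V) (c : Y → ℝ) (hc : ∀ y, 0 ≤ c y) :
    ∃ c' : Y → ℝ, (∀ y, 0 ≤ c' y) ∧ ∑ y, c' y • v y = ∑ y, c y • v y ∧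
      (Finset.univ.filter fun y => c' y ≠ 0).card ≤ Module.finrank ℝ V := by
  classical
  induction h : (Finset.univ.filter fun y => c y ≠ 0).card using Nat.strong_induction_on
    generalizing c with
  | _ n ih =>
  by_cases hn : n ≤ Module.finrank ℝ V
  · exact ⟨c, hc, rfl, h ▸ hn⟩
  -- a linear relation among the vectors in the support, with a positive coefficient
  obtain ⟨g, hg, hgs, i, hi⟩ : ∃ g : Y → ℝ, ∑ y, g y • v y = 0 ∧ (∀ y, c y = 0 → g y = 0) ∧
      ∃ i, 0 < g i := by
    have hdep : ¬ LinearIndependent ℝ fun y : {y // c y ≠ 0} => v y := fun hli => by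
      have := hli.fintype_card_le_finrank
      rw [Fintype.card_subtype, h] at this
      exact hn this
    obtain ⟨g, hg, i, hi⟩ := Fintype.not_linearIndependent_iff.1 hdep
    have hext : ∀ s : ℝ, ∑ y, (if h : c y ≠ 0 then s * g ⟨y, h⟩ else 0) • v y = 0 := by
      intro s
      have h0 : ∑ i, (s * g i) • v i = 0 := by
        simp only [mul_smul, ← Finset.smul_sum, hg, smul_zero]
      refine Eq.trans (Eq.symm ?_) h0
      refine (Fintype.sum_of_injective (Subtype.val : {y // c y ≠ 0} → Y)
        Subtype.val_injective _ _ ?_ ?_)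
      · intro y hy
        rw [dif_neg, zero_smul]
        intro hy'
        exact hy ⟨⟨y, hy'⟩, rfl⟩
      · rintro ⟨y, hy⟩
        rw [dif_pos hy]
    rcases lt_or_gt_of_ne hi with hi' | hi'
    · refine ⟨fun y => if h : c y ≠ 0 then -1 * g ⟨y, h⟩ else 0, hext (-1), ?_, i, ?_⟩
      · intro y hy; simp [hy]
      · beta_reduce; rw [dif_pos i.2]; linarith
    · refine ⟨fun y => if h : c y ≠ 0 then 1 * g ⟨y, h⟩ else 0, hext 1, ?_, i, ?_⟩
      · intro y hy; simp [hy]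
      · beta_reduce; rw [dif_pos i.2]; linarith
  -- subtract the largest multiple of the relation that keeps the coefficients nonnegative
  obtain ⟨j, hj, hmin⟩ := Finset.exists_min_image (Finset.univ.filter fun y => 0 < g y)
    (fun y => c y / g y) ⟨i, by simp [hi]⟩
  have hgj : 0 < g j := by simpa using hj
  have hnn : ∀ y, 0 ≤ c y - c j / g j * g y := by
    intro y
    rcases le_or_gt (g y) 0 with hy | hy
    · have := mul_nonneg (div_nonneg (hc j) hgj.le) (neg_nonneg.2 hy)
      have := hc y
      linarith
    · have h1 := hmin y (by simp [hy])
      have h2 := mul_le_mul_of_nonneg_right h1 hy.le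
      rw [div_mul_cancel₀ _ hy.ne'] at h2
      linarith
  have hsub : (Finset.univ.filter fun y => c y - c j / g j * g y ≠ 0) ⊂
      Finset.univ.filter fun y => c y ≠ 0 := by
    refine (Finset.ssubset_iff_of_subset ?_).2 ⟨j, ?_, ?_⟩
    · intro y
      simp only [Finset.mem_filter, Finset.mem_univ, true_and]
      intro hy hcy
      exact hy (by rw [hcy, hgs y hcy, mul_zero, sub_zero])
    · simp only [Finset.mem_filter, Finset.mem_univ, true_and]
      intro hcj
      exact hgj.ne' (hgs j hcj)
    · simp [div_mul_cancel₀ _ hgj.ne']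
  obtain ⟨c', h1, h2, h3⟩ := ih _ (h ▸ Finset.card_lt_card hsub) _ hnn rfl
  refine ⟨c', h1, h2.trans ?_, h3⟩
  simp only [sub_smul, Finset.sum_sub_distrib, mul_smul, ← Finset.smul_sum, hg, smul_zero, sub_zero]

section Channel

variable {X B Y Y' : Type*} [Fintype X] [Fintype B] [DecidableEq B]
  [Fintype Y] [Fintype Y'] {p : X → ℝ} {ρ : X → Matrix B B ℂ}

theorem homShannon_smul (c : ℝ) (w : X → ℝ) :
    homShannon (fun x => c * w x) = c * homShannon w := by
  simp only [homShannon, ← Finset.mul_sum, eta_mul, Finset.sum_add_distrib, ← Finset.sum_mul]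
  ring

@[simp] theorem homShannon_zero : homShannon (fun _ : X => 0) = 0 := by simp [homShannon]

theorem homEntropy_smul (c : ℝ) {M : Matrix B B ℂ} (hM : M.IsHermitian) :
    homEntropy ((c : ℂ) • M) = c * homEntropy M := by
  rw [homEntropy, homEntropy, entropy_smul c hM, Matrix.trace_smul, smul_eq_mul,
    Complex.re_ofReal_mul, eta_mul]
  ring

@[simp] theorem homEntropy_zero : homEntropy (0 : Matrix B B ℂ) = 0 := by
  simpa using homEntropy_smul 0 (Matrix.isHermitian_zero (n := B) (α := ℂ))

omit [DecidableEq B] [Fintype Y] in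
theorem condState_isHermitian (hρ : ∀ x, IsDensity (ρ x)) (Q : X → Y → ℝ) (y : Y) :
    (condState p ρ Q y).IsHermitian :=
  isHermitian_smul_sum hρ fun x => p x * Q x y

omit [Fintype B] [DecidableEq B] [Fintype Y] [Fintype Y'] in
theorem condState_smul (c : ℝ) (Q : X → Y → ℝ) (Q' : X → Y' → ℝ) (y : Y) (y' : Y')
    (h : ∀ x, Q' x y' = c * Q x y) : condState p ρ Q' y' = (c : ℂ) • condState p ρ Q y := by
  rw [condState, condState, Finset.smul_sum]
  refine Finset.sum_congr rfl fun x _ => ?_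
  rw [h, smul_smul]
  push_cast; ring_nf

/-- Outputs `f z` of a channel, with probabilities rescaled by `c z` and relabelled by `g`, form a
channel with the same informations if the total probabilities and the total conditional entropies
are unchanged. -/
theorem channel_of_rescale (hρ : ∀ x, IsDensity (ρ x)) {Q : X → Y → ℝ} (hQ : IsChannel Q)
    {Z : Type*} [Fintype Z] (f : Z → Y) (g : Z → Y') (hg : Function.Injective g) (c : Z → ℝ)
    (hc : ∀ z, 0 ≤ c z) (h1 : ∀ x, ∑ z, c z * Q x (f z) = ∑ y, Q x y)
    (h2 : ∑ z, c z * homShannon (fun x => p x * Q x (f z)) =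
      ∑ y, homShannon fun x => p x * Q x y)
    (h3 : ∑ z, c z * homEntropy (condState p ρ Q (f z)) = ∑ y, homEntropy (condState p ρ Q y)) :
    ∃ Q' : X → Y' → ℝ, IsChannel Q' ∧ inputInfo p Q' = inputInfo p Q ∧
      outputInfo p ρ Q' = outputInfo p ρ Q := by
  classical
  let Q' : X → Y' → ℝ := fun x => Function.extend g (fun z => c z * Q x (f z)) 0
  have hin : ∀ x z, Q' x (g z) = c z * Q x (f z) := fun x z => hg.extend_apply _ _ _
  have hout : ∀ x y, y ∉ Set.range g → Q' x y = 0 := fun x y hy =>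
    Function.extend_apply' _ _ _ fun ⟨z, hz⟩ => hy ⟨z, hz⟩
  refine ⟨Q', fun x => ⟨fun y => ?_, ?_⟩, ?_, ?_⟩
  · by_cases hy : y ∈ Set.range g
    · obtain ⟨z, rfl⟩ := hy
      rw [hin]; exact mul_nonneg (hc z) ((hQ x).1 _)
    · rw [hout x y hy]
  · rw [← (hQ x).2, ← h1 x]
    exact (Fintype.sum_of_injective g hg _ _ (fun y hy => hout x y hy)
      fun z => (hin x z).symm).symm
  · rw [inputInfo, inputInfo, ← h2]
    congr 1
    refine (Fintype.sum_of_injective g hg _ _ (fun y hy => ?_) fun z => ?_).symm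
    · simp [hout _ y hy]
    · rw [← homShannon_smul]; congr 1; funext x; rw [hin]; ring
  · rw [outputInfo, outputInfo, ← h3]
    congr 1
    refine (Fintype.sum_of_injective g hg _ _ (fun y hy => ?_) fun z => ?_).symm
    · simp [condState, hout _ y hy]
    · rw [condState_smul (c z) Q Q' (f z) (g z) fun x => hin x z,
        homEntropy_smul _ (condState_isHermitian hρ Q _)]

/-- The output alphabet of a channel may be any finite type instead of `Fin m`. -/
theorem exists_channel_fin (hρ : ∀ x, IsDensity (ρ x)) {Q : X → Y → ℝ} (hQ : IsChannel Q) :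
    ∃ (m : ℕ) (Q' : X → Fin m → ℝ), IsChannel Q' ∧ inputInfo p Q' = inputInfo p Q ∧
      outputInfo p ρ Q' = outputInfo p ρ Q :=
  ⟨Fintype.card Y, channel_of_rescale hρ hQ (Z := Y) id (Fintype.equivFin Y)
    (Fintype.equivFin Y).injective (fun _ => 1) (fun _ => zero_le_one) (by simp) (by simp)
    (by simp)⟩

/-- `|X| + 2` output letters suffice to realize the informations of any channel: the vectors
`(Q(y|·), H, S)`, with `H` and `S` the contributions of `y` to the two conditional entropies, are
homogeneous in `Q(y|·)` and live in a space of that dimension. -/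
theorem exists_channel_card (hρ : ∀ x, IsDensity (ρ x)) {Q : X → Y → ℝ} (hQ : IsChannel Q)
    {k : ℕ} (hk : Fintype.card X + 2 ≤ k) :
    ∃ Q' : X → Fin k → ℝ, IsChannel Q' ∧ inputInfo p Q' = inputInfo p Q ∧
      outputInfo p ρ Q' = outputInfo p ρ Q := by
  classical
  obtain ⟨c, hc, hsum, hcard⟩ := exists_conic_reduction
    (fun y => ((fun x => Q x y, homShannon fun x => p x * Q x y,
      homEntropy (condState p ρ Q y)) : (X → ℝ) × ℝ × ℝ)) (fun _ => 1) fun _ => zero_le_one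
  have hcard' : Fintype.card {y // c y ≠ 0} ≤ Fintype.card (Fin k) := by
    rw [Fintype.card_subtype, Fintype.card_fin]
    refine (hcard.trans_eq ?_).trans hk
    simp
  obtain ⟨g⟩ := Function.Embedding.nonempty_of_card_le hcard'
  have hsupp : ∀ φ : Y → ℝ, ∑ z : {y // c y ≠ 0}, c z * φ z = ∑ y, c y * φ y := fun φ =>
    Fintype.sum_of_injective (Subtype.val : {y // c y ≠ 0} → Y) Subtype.val_injective _ _
      (fun y hy => by
        have : c y = 0 := by
          by_contra h
          exact hy ⟨⟨y, h⟩, rfl⟩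
        rw [this, zero_mul]) fun _ => rfl
  simp only [one_smul] at hsum
  refine channel_of_rescale hρ hQ Subtype.val g g.injective (fun z => c z) (fun z => hc z)
    (fun x => ?_) ?_ ?_
  · rw [hsupp fun y => Q x y]
    have := congrFun (congrArg Prod.fst hsum) x
    simpa [Prod.fst_sum, Finset.sum_apply] using this
  · rw [hsupp fun y => homShannon fun x => p x * Q x y]
    have := congrArg (fun v => v.2.1) hsum
    simpa [Prod.fst_sum, Prod.snd_sum] using this
  · rw [hsupp fun y => homEntropy (condState p ρ Q y)]
    have := congrArg (fun v => v.2.2) hsum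
    simpa [Prod.snd_sum] using this

theorem continuous_inputInfo (p : X → ℝ) : Continuous fun Q : X → Y → ℝ => inputInfo p Q := by
  have hc : ∀ x y, Continuous fun Q : X → Y → ℝ => p x * Q x y := fun x y => by fun_prop
  unfold inputInfo homShannon
  refine continuous_const.sub (continuous_finsetSum _ fun y _ => Continuous.sub
    (continuous_finsetSum _ fun x _ => continuous_eta.comp (hc x y))
    (continuous_eta.comp (continuous_finsetSum _ fun x _ => hc x y)))

theorem continuous_outputInfo (hρ : ∀ x, IsDensity (ρ x)) :
    Continuous fun Q : X → Y → ℝ => outputInfo p ρ Q := by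
  have hc : ∀ y, Continuous fun Q : X → Y → ℝ => condState p ρ Q y := fun y => by
    unfold condState
    refine continuous_finsetSum _ fun x _ => Continuous.smul (Complex.continuous_ofReal.comp ?_)
      continuous_const
    fun_prop
  unfold outputInfo homEntropy
  refine continuous_const.sub (continuous_finsetSum _ fun y _ => Continuous.sub
    (continuous_entropy (hc y) fun Q => condState_isHermitian hρ Q y)
    (continuous_eta.comp (Complex.continuous_re.comp (hc y).matrix_trace)))

theorem isChannel_const (X : Type*) : IsChannel fun (_ : X) (_ : Fin 1) => (1 : ℝ) :=
  fun _ => ⟨fun _ => zero_le_one, by simp⟩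

theorem inputInfo_const (hp : p ∈ stdSimplex ℝ X) :
    inputInfo p (fun (_ : X) (_ : Fin 1) => (1 : ℝ)) = 0 := by
  simp [inputInfo, homShannon, hp.2]

theorem outputInfo_const (hp : p ∈ stdSimplex ℝ X) (hρ : ∀ x, IsDensity (ρ x)) :
    outputInfo p ρ (fun (_ : X) (_ : Fin 1) => (1 : ℝ)) = 0 := by
  have htr : ∀ x, (ρ x).trace.re = 1 := fun x => by rw [(hρ x).2, Complex.one_re]
  simp [outputInfo, homEntropy, condState, hp.2, htr]

/-- `Q` attains the single-copy maximum of `I(Y;B)` under the constraint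
`I(Y;X) - c I(Y;B) ≤ r`. -/
def IsOptimalChannel (p : X → ℝ) (ρ : X → Matrix B B ℂ) (c r : ℝ) {k : ℕ} (Q : X → Fin k → ℝ) :
    Prop :=
  IsChannel Q ∧ inputInfo p Q - c * outputInfo p ρ Q ≤ r ∧
    ∀ (m : ℕ) (Q' : X → Fin m → ℝ), IsChannel Q' →
      inputInfo p Q' - c * outputInfo p ρ Q' ≤ r → outputInfo p ρ Q' ≤ outputInfo p ρ Q

theorem exists_optimal_channel (hp : p ∈ stdSimplex ℝ X) (hρ : ∀ x, IsDensity (ρ x)) (c : ℝ)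
    {r : ℝ} (hr : 0 ≤ r) :
    ∃ Q : X → Fin (Fintype.card X + 2) → ℝ, IsOptimalChannel p ρ c r Q := by
  set k := Fintype.card X + 2 with hk
  have hK : IsCompact {Q : X → Fin k → ℝ | IsChannel Q} := by
    have := isCompact_univ_pi fun _ : X => isCompact_stdSimplex (𝕜 := ℝ) (Fin k)
    refine this.of_isClosed_subset ?_ ?_
    · convert this.isClosed using 1
      ext Q; simp [IsChannel]
    · intro Q hQ; simpa [IsChannel] using hQ
  have hcont := (continuous_inputInfo (Y := Fin k) p).sub
    ((continuous_outputInfo (Y := Fin k) (p := p) hρ).const_mul c)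
  have hF : IsCompact ({Q : X → Fin k → ℝ | IsChannel Q} ∩
      {Q | inputInfo p Q - c * outputInfo p ρ Q ≤ r}) :=
    hK.inter_right (isClosed_le hcont continuous_const)
  have hne : ({Q : X → Fin k → ℝ | IsChannel Q} ∩
      {Q | inputInfo p Q - c * outputInfo p ρ Q ≤ r}).Nonempty := by
    obtain ⟨Q, h1, h2, h3⟩ := exists_channel_card (p := p) hρ (isChannel_const X) hk.ge
    refine ⟨Q, h1, ?_⟩
    rwa [Set.mem_ofPred_eq, h2, h3, inputInfo_const hp, outputInfo_const hp hρ, mul_zero, sub_zero]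
  obtain ⟨Q, hQ, hmax⟩ := hF.exists_isMaxOn hne (continuous_outputInfo hρ).continuousOn
  refine ⟨Q, hQ.1, hQ.2, fun m Q' h1 h2 => ?_⟩
  obtain ⟨Q'', h3, h4, h5⟩ := exists_channel_card (p := p) hρ h1 hk.ge
  rw [← h5]
  exact hmax ⟨h3, by rw [Set.mem_ofPred_eq, h4, h5]; exact h2⟩

end Channel

/-! ### Products of sources and channels -/

section Product

variable {X X₁ X₂ B B₁ B₂ Y Y₁ Y₂ : Type*} [Fintype X] [Fintype X₁] [Fintype X₂]
  [Fintype B] [DecidableEq B]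
  [Fintype B₁] [DecidableEq B₁] [Fintype B₂] [DecidableEq B₂] [Fintype Y] [Fintype Y₁] [Fintype Y₂]
  {p : X → ℝ} {p₁ : X₁ → ℝ} {p₂ : X₂ → ℝ}
  {ρ : X → Matrix B B ℂ} {ρ₁ : X₁ → Matrix B₁ B₁ ℂ} {ρ₂ : X₂ → Matrix B₂ B₂ ℂ}

/-- Product distribution of two sources. -/
def prodDist (p₁ : X₁ → ℝ) (p₂ : X₂ → ℝ) (x : X₁ × X₂) : ℝ := p₁ x.1 * p₂ x.2

/-- Product states of two sources. -/
def prodStates (ρ₁ : X₁ → Matrix B₁ B₁ ℂ) (ρ₂ : X₂ → Matrix B₂ B₂ ℂ) (x : X₁ × X₂) :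
    Matrix (B₁ × B₂) (B₁ × B₂) ℂ := ρ₁ x.1 ⊗ₖ ρ₂ x.2

theorem sum_eta_prodDist (hp₁ : p₁ ∈ stdSimplex ℝ X₁) (hp₂ : p₂ ∈ stdSimplex ℝ X₂) :
    ∑ x, eta (prodDist p₁ p₂ x) = ∑ x, eta (p₁ x) + ∑ x, eta (p₂ x) := by
  simp only [prodDist, Fintype.sum_prod_type, eta_mul, Finset.sum_add_distrib, ← Finset.sum_mul,
    ← Finset.mul_sum, hp₁.2, hp₂.2, one_mul]

omit [DecidableEq B] in
theorem trace_average (hp : p ∈ stdSimplex ℝ X) (hρ : ∀ x, IsDensity (ρ x)) :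
    (∑ x, (p x : ℂ) • ρ x).trace.re = 1 := by
  rw [Matrix.trace_sum, Complex.re_sum, ← hp.2]
  exact Finset.sum_congr rfl fun x _ => by simp [(hρ x).2]

omit [Fintype B₁] [DecidableEq B₁] [Fintype B₂] [DecidableEq B₂] in
theorem sum_smul_kronecker (a : X₁ → ℂ) (b : X₂ → ℂ) :
    ∑ x : X₁ × X₂, (a x.1 * b x.2) • (ρ₁ x.1 ⊗ₖ ρ₂ x.2) =
      (∑ x, a x • ρ₁ x) ⊗ₖ (∑ x, b x • ρ₂ x) := by
  ext i j
  simp only [Matrix.sum_apply, Matrix.smul_apply, Matrix.kroneckerMap_apply, smul_eq_mul,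
    Finset.sum_mul_sum, Fintype.sum_prod_type]
  refine Finset.sum_congr rfl fun x _ => Finset.sum_congr rfl fun x' _ => ?_
  ring

theorem entropy_average_prod (hp₁ : p₁ ∈ stdSimplex ℝ X₁) (hp₂ : p₂ ∈ stdSimplex ℝ X₂)
    (hρ₁ : ∀ x, IsDensity (ρ₁ x)) (hρ₂ : ∀ x, IsDensity (ρ₂ x)) :
    entropy (∑ x, (prodDist p₁ p₂ x : ℂ) • prodStates ρ₁ ρ₂ x) =
      entropy (∑ x, (p₁ x : ℂ) • ρ₁ x) + entropy (∑ x, (p₂ x : ℂ) • ρ₂ x) := by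
  simp only [prodDist, prodStates, Complex.ofReal_mul]
  rw [sum_smul_kronecker (fun x => (p₁ x : ℂ)) fun x => (p₂ x : ℂ),
    entropy_kronecker (isHermitian_smul_sum hρ₁ p₁) (isHermitian_smul_sum hρ₂ p₂),
    trace_average hp₁ hρ₁, trace_average hp₂ hρ₂, one_mul, one_mul]

omit [DecidableEq B] [Fintype Y] in
theorem trace_condState (hρ : ∀ x, IsDensity (ρ x)) (Q : X → Y → ℝ) (y : Y) :
    (condState p ρ Q y).trace.re = ∑ x, p x * Q x y := by
  rw [condState, Matrix.trace_sum, Complex.re_sum]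
  exact Finset.sum_congr rfl fun x _ => by simp [(hρ x).2]

omit [DecidableEq B] in
theorem condState_posSemidef (hp : ∀ x, 0 ≤ p x) (hρ : ∀ x, IsDensity (ρ x)) {Q : X → Y → ℝ}
    (hQ : IsChannel Q) (y : Y) : (condState p ρ Q y).PosSemidef :=
  Matrix.posSemidef_sum _ fun x _ => (hρ x).1.smul
    (by exact_mod_cast mul_nonneg (hp x) ((hQ x).1 y))

/-- The channel from the first input to the output, averaged over the second input. -/
def marginalChannel (p₂ : X₂ → ℝ) (Q : X₁ × X₂ → Y → ℝ) (x₁ : X₁) (y : Y) : ℝ :=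
  ∑ x₂, p₂ x₂ * Q (x₁, x₂) y

/-- The channel from the second input to the pair of the output and the first input. -/
def revealingChannel (p₁ : X₁ → ℝ) (Q : X₁ × X₂ → Y → ℝ) (x₂ : X₂) (z : Y × X₁) : ℝ :=
  p₁ z.2 * Q (z.2, x₂) z.1

omit [Fintype X₁] in
theorem isChannel_marginalChannel (hp₂ : p₂ ∈ stdSimplex ℝ X₂) {Q : X₁ × X₂ → Y → ℝ}
    (hQ : IsChannel Q) : IsChannel (marginalChannel p₂ Q) := by
  intro x
  refine ⟨fun y => Finset.sum_nonneg fun x₂ _ => mul_nonneg (hp₂.1 x₂) ((hQ _).1 y), ?_⟩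
  simp only [marginalChannel]
  rw [Finset.sum_comm]
  simp only [← Finset.mul_sum, (hQ _).2, mul_one, hp₂.2]

omit [Fintype X₂] in
theorem isChannel_revealingChannel (hp₁ : p₁ ∈ stdSimplex ℝ X₁) {Q : X₁ × X₂ → Y → ℝ}
    (hQ : IsChannel Q) : IsChannel (revealingChannel p₁ Q) := by
  intro x
  refine ⟨fun z => mul_nonneg (hp₁.1 z.2) ((hQ _).1 z.1), ?_⟩
  simp only [revealingChannel]
  rw [Fintype.sum_prod_type, Finset.sum_comm]
  simp only [← Finset.mul_sum, (hQ _).2, mul_one, hp₁.2]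

/-- The chain rule `I(Y;X₁X₂) = I(Y;X₁) + I(YX₁;X₂)` for independent inputs. -/
theorem inputInfo_prodDist (hp₁ : p₁ ∈ stdSimplex ℝ X₁) (hp₂ : p₂ ∈ stdSimplex ℝ X₂)
    (Q : X₁ × X₂ → Y → ℝ) :
    inputInfo (prodDist p₁ p₂) Q =
      inputInfo p₁ (marginalChannel p₂ Q) + inputInfo p₂ (revealingChannel p₁ Q) := by
  have key : ∀ y, homShannon (fun x => prodDist p₁ p₂ x * Q x y) =
      homShannon (fun x => p₁ x * marginalChannel p₂ Q x y) +
        ∑ x₁, homShannon fun x => p₂ x * revealingChannel p₁ Q x (y, x₁) := by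
    intro y
    have h1 : ∀ x₁ x₂, prodDist p₁ p₂ (x₁, x₂) * Q (x₁, x₂) y =
        p₂ x₂ * revealingChannel p₁ Q x₂ (y, x₁) := fun x₁ x₂ => by
      simp only [prodDist, revealingChannel]; ring
    have h2 : ∀ x₁, p₁ x₁ * marginalChannel p₂ Q x₁ y =
        ∑ x₂, p₂ x₂ * revealingChannel p₁ Q x₂ (y, x₁) := fun x₁ => by
      simp only [marginalChannel, revealingChannel, Finset.mul_sum]
      exact Finset.sum_congr rfl fun _ _ => by ring
    simp only [homShannon, Fintype.sum_prod_type, h1, h2, Finset.sum_sub_distrib]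
    ring
  simp only [inputInfo, key, sum_eta_prodDist hp₁ hp₂, Finset.sum_add_distrib,
    Fintype.sum_prod_type]
  ring

/-- `I(Y;B₁B₂) ≤ I(Y;B₁) + I(YX₁;B₂)`: the conditional entropy of `B₂` given the quantum system `B₁`
is at least that given its preparation `X₁`. -/
theorem outputInfo_prod_le (hp₁ : p₁ ∈ stdSimplex ℝ X₁) (hp₂ : p₂ ∈ stdSimplex ℝ X₂)
    (hρ₁ : ∀ x, IsDensity (ρ₁ x)) (hρ₂ : ∀ x, IsDensity (ρ₂ x)) {Q : X₁ × X₂ → Y → ℝ}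
    (hQ : IsChannel Q) :
    outputInfo (prodDist p₁ p₂) (prodStates ρ₁ ρ₂) Q ≤
      outputInfo p₁ ρ₁ (marginalChannel p₂ Q) + outputInfo p₂ ρ₂ (revealingChannel p₁ Q) := by
  classical
  have key : ∀ y, homEntropy (condState p₁ ρ₁ (marginalChannel p₂ Q) y) +
      ∑ x₁, homEntropy (condState p₂ ρ₂ (revealingChannel p₁ Q) (y, x₁)) ≤
      homEntropy (condState (prodDist p₁ p₂) (prodStates ρ₁ ρ₂) Q y) := by
    intro y
    have hN := fun x₁ => condState_posSemidef hp₂.1 hρ₂ (isChannel_revealingChannel hp₁ hQ) (y, x₁)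
    have htr : ∀ x₁, (condState p₂ ρ₂ (revealingChannel p₁ Q) (y, x₁)).trace.re =
        p₁ x₁ * marginalChannel p₂ Q x₁ y := by
      intro x₁
      rw [trace_condState hρ₂]
      simp only [marginalChannel, revealingChannel, Finset.mul_sum]
      exact Finset.sum_congr rfl fun _ _ => by ring
    have h := entropy_add_sum_le_entropy_sum_kronecker hρ₁ hN
    have hM : ∑ x₁, ρ₁ x₁ ⊗ₖ condState p₂ ρ₂ (revealingChannel p₁ Q) (y, x₁) =
        condState (prodDist p₁ p₂) (prodStates ρ₁ ρ₂) Q y := by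
      ext i j
      simp only [condState, Matrix.sum_apply, Matrix.smul_apply, Matrix.kroneckerMap_apply,
        smul_eq_mul, Fintype.sum_prod_type, Finset.mul_sum, prodDist, prodStates, revealingChannel]
      refine Finset.sum_congr rfl fun x _ => Finset.sum_congr rfl fun x' _ => ?_
      push_cast; ring
    have hL : ∑ x₁, ((condState p₂ ρ₂ (revealingChannel p₁ Q) (y, x₁)).trace.re : ℂ) • ρ₁ x₁ =
        condState p₁ ρ₁ (marginalChannel p₂ Q) y := by
      simp only [htr]; rfl
    have hT : (condState (prodDist p₁ p₂) (prodStates ρ₁ ρ₂) Q y).trace.re =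
        (condState p₁ ρ₁ (marginalChannel p₂ Q) y).trace.re := by
      rw [trace_condState hρ₁, ← hM, Matrix.trace_sum, Complex.re_sum]
      refine Finset.sum_congr rfl fun x₁ _ => ?_
      rw [Matrix.trace_kronecker, (hρ₁ x₁).2, one_mul, htr]
    rw [hM, hL] at h
    rw [homEntropy, homEntropy, hT]
    change entropy _ + ∑ x₁, homEntropy _ ≤ _ at h
    linarith
  rw [outputInfo, outputInfo, outputInfo, entropy_average_prod hp₁ hp₂ hρ₁ hρ₂,
    Fintype.sum_prod_type]
  have := Finset.sum_le_sum fun y (_ : y ∈ Finset.univ) => key y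
  rw [Finset.sum_add_distrib] at this
  linarith

/-- Two channels used in parallel. -/
def prodChannel (Q₁ : X₁ → Y₁ → ℝ) (Q₂ : X₂ → Y₂ → ℝ) (x : X₁ × X₂) (y : Y₁ × Y₂) : ℝ :=
  Q₁ x.1 y.1 * Q₂ x.2 y.2

omit [Fintype X₁] [Fintype X₂] in
theorem isChannel_prodChannel {Q₁ : X₁ → Y₁ → ℝ} {Q₂ : X₂ → Y₂ → ℝ} (h₁ : IsChannel Q₁)
    (h₂ : IsChannel Q₂) : IsChannel (prodChannel Q₁ Q₂) := by
  intro x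
  refine ⟨fun y => mul_nonneg ((h₁ _).1 _) ((h₂ _).1 _), ?_⟩
  simp only [prodChannel, Fintype.sum_prod_type, ← Finset.mul_sum, (h₂ _).2, mul_one, (h₁ _).2]

theorem sum_sum_mul_channel (hp : p ∈ stdSimplex ℝ X) {Q : X → Y → ℝ} (hQ : IsChannel Q) :
    ∑ y, ∑ x, p x * Q x y = 1 := by
  rw [Finset.sum_comm]
  simp only [← Finset.mul_sum, (hQ _).2, mul_one, hp.2]

theorem inputInfo_prodChannel (hp₁ : p₁ ∈ stdSimplex ℝ X₁) (hp₂ : p₂ ∈ stdSimplex ℝ X₂)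
    {Q₁ : X₁ → Y₁ → ℝ} {Q₂ : X₂ → Y₂ → ℝ} (h₁ : IsChannel Q₁) (h₂ : IsChannel Q₂) :
    inputInfo (prodDist p₁ p₂) (prodChannel Q₁ Q₂) = inputInfo p₁ Q₁ + inputInfo p₂ Q₂ := by
  have key : ∀ y₁ y₂, homShannon (fun x => prodDist p₁ p₂ x * prodChannel Q₁ Q₂ x (y₁, y₂)) =
      (∑ x, p₂ x * Q₂ x y₂) * homShannon (fun x => p₁ x * Q₁ x y₁) +
        (∑ x, p₁ x * Q₁ x y₁) * homShannon (fun x => p₂ x * Q₂ x y₂) := by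
    intro y₁ y₂
    have h : ∀ x₁ x₂, prodDist p₁ p₂ (x₁, x₂) * prodChannel Q₁ Q₂ (x₁, x₂) (y₁, y₂) =
        (p₁ x₁ * Q₁ x₁ y₁) * (p₂ x₂ * Q₂ x₂ y₂) := fun x₁ x₂ => by
      simp only [prodDist, prodChannel]; ring
    simp only [homShannon, Fintype.sum_prod_type, h, eta_mul, Finset.sum_add_distrib,
      ← Finset.sum_mul, ← Finset.mul_sum]
    ring
  simp only [inputInfo, Fintype.sum_prod_type, key, sum_eta_prodDist hp₁ hp₂,
    Finset.sum_add_distrib, ← Finset.sum_mul, ← Finset.mul_sum, sum_sum_mul_channel hp₁ h₁,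
    sum_sum_mul_channel hp₂ h₂, one_mul]
  ring

theorem homEntropy_kronecker {M : Matrix B₁ B₁ ℂ} {N : Matrix B₂ B₂ ℂ} (hM : M.IsHermitian)
    (hN : N.IsHermitian) :
    homEntropy (M ⊗ₖ N) = N.trace.re * homEntropy M + M.trace.re * homEntropy N := by
  have h : (M ⊗ₖ N).trace.re = M.trace.re * N.trace.re := by
    rw [Matrix.trace_kronecker, trace_eq_re hM, Complex.re_ofReal_mul, Complex.ofReal_re]
  simp only [homEntropy, entropy_kronecker hM hN, h, eta_mul]
  ring

theorem outputInfo_prodChannel (hp₁ : p₁ ∈ stdSimplex ℝ X₁) (hp₂ : p₂ ∈ stdSimplex ℝ X₂)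
    (hρ₁ : ∀ x, IsDensity (ρ₁ x)) (hρ₂ : ∀ x, IsDensity (ρ₂ x))
    {Q₁ : X₁ → Y₁ → ℝ} {Q₂ : X₂ → Y₂ → ℝ} (h₁ : IsChannel Q₁) (h₂ : IsChannel Q₂) :
    outputInfo (prodDist p₁ p₂) (prodStates ρ₁ ρ₂) (prodChannel Q₁ Q₂) =
      outputInfo p₁ ρ₁ Q₁ + outputInfo p₂ ρ₂ Q₂ := by
  have key : ∀ y₁ y₂,
      homEntropy (condState (prodDist p₁ p₂) (prodStates ρ₁ ρ₂) (prodChannel Q₁ Q₂) (y₁, y₂)) =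
      (∑ x, p₂ x * Q₂ x y₂) * homEntropy (condState p₁ ρ₁ Q₁ y₁) +
        (∑ x, p₁ x * Q₁ x y₁) * homEntropy (condState p₂ ρ₂ Q₂ y₂) := by
    intro y₁ y₂
    have h : condState (prodDist p₁ p₂) (prodStates ρ₁ ρ₂) (prodChannel Q₁ Q₂) (y₁, y₂) =
        condState p₁ ρ₁ Q₁ y₁ ⊗ₖ condState p₂ ρ₂ Q₂ y₂ := by
      rw [condState, condState, condState, ← sum_smul_kronecker]
      refine Finset.sum_congr rfl fun x _ => ?_
      simp only [prodDist, prodStates, prodChannel]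
      push_cast; ring_nf
    rw [h, homEntropy_kronecker (condState_isHermitian hρ₁ _ _) (condState_isHermitian hρ₂ _ _),
      trace_condState hρ₁, trace_condState hρ₂]
  rw [outputInfo, outputInfo, outputInfo, entropy_average_prod hp₁ hp₂ hρ₁ hρ₂]
  simp only [Fintype.sum_prod_type, key,
    Finset.sum_add_distrib, ← Finset.sum_mul, ← Finset.mul_sum, sum_sum_mul_channel hp₁ h₁,
    sum_sum_mul_channel hp₂ h₂, one_mul]
  ring

/-- Time sharing: the channel `Q₁` used with probability `a`, and `Q₂` with probability `b`. -/
def mixChannel (a b : ℝ) (Q₁ : X → Y₁ → ℝ) (Q₂ : X → Y₂ → ℝ) (x : X) : Y₁ ⊕ Y₂ → ℝ :=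
  Sum.elim (fun y => a * Q₁ x y) fun y => b * Q₂ x y

omit [Fintype X] in
theorem isChannel_mixChannel {a b : ℝ} (ha : 0 ≤ a) (hb : 0 ≤ b) (hab : a + b = 1)
    {Q₁ : X → Y₁ → ℝ} {Q₂ : X → Y₂ → ℝ} (h₁ : IsChannel Q₁)
    (h₂ : IsChannel Q₂) : IsChannel (mixChannel a b Q₁ Q₂) := by
  intro x
  refine ⟨?_, ?_⟩
  · rintro (y | y)
    · exact mul_nonneg ha ((h₁ x).1 y)
    · exact mul_nonneg hb ((h₂ x).1 y)
  · simp [mixChannel, ← Finset.mul_sum, (h₁ x).2, (h₂ x).2, hab]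

theorem inputInfo_mixChannel {a b : ℝ} (hab : a + b = 1) (Q₁ : X → Y₁ → ℝ) (Q₂ : X → Y₂ → ℝ) :
    inputInfo p (mixChannel a b Q₁ Q₂) = a * inputInfo p Q₁ + b * inputInfo p Q₂ := by
  have h : ∀ (c : ℝ) {Z : Type _} (Q : X → Z → ℝ) (z : Z), homShannon (fun x => p x * (c * Q x z)) =
      c * homShannon (fun x => p x * Q x z) := fun c Z Q z => by
    rw [← homShannon_smul]; congr 1; funext x; ring
  simp only [inputInfo, Fintype.sum_sum_type, mixChannel, Sum.elim_inl, Sum.elim_inr]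
  have e1 := h a Q₁
  have e2 : ∀ z, homShannon (fun x => p x * (b * Q₂ x z)) =
      b * homShannon (fun x => p x * Q₂ x z) := fun z => by
    rw [← homShannon_smul]; congr 1; funext x; ring
  simp only [e1, e2, ← Finset.mul_sum]
  linear_combination (-(∑ x, eta (p x))) * hab

theorem outputInfo_mixChannel {a b : ℝ} (hab : a + b = 1) (hρ : ∀ x, IsDensity (ρ x))
    (Q₁ : X → Y₁ → ℝ) (Q₂ : X → Y₂ → ℝ) :
    outputInfo p ρ (mixChannel a b Q₁ Q₂) = a * outputInfo p ρ Q₁ + b * outputInfo p ρ Q₂ := by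
  have e1 : ∀ y, homEntropy (condState p ρ (mixChannel a b Q₁ Q₂) (Sum.inl y)) =
      a * homEntropy (condState p ρ Q₁ y) := fun y => by
    rw [condState_smul a Q₁ (mixChannel a b Q₁ Q₂) y (Sum.inl y) fun x => rfl,
      homEntropy_smul _ (condState_isHermitian hρ _ _)]
  have e2 : ∀ y, homEntropy (condState p ρ (mixChannel a b Q₁ Q₂) (Sum.inr y)) =
      b * homEntropy (condState p ρ Q₂ y) := fun y => by
    rw [condState_smul b Q₂ (mixChannel a b Q₁ Q₂) y (Sum.inr y) fun x => rfl,
      homEntropy_smul _ (condState_isHermitian hρ _ _)]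
  simp only [outputInfo, Fintype.sum_sum_type, e1, e2, ← Finset.mul_sum]
  linear_combination (-(entropy (∑ x, (p x : ℂ) • ρ x))) * hab

/-! ### Single-letterization -/

theorem inputInfo_equiv (e : X₁ ≃ X) (Q : X → Y → ℝ) :
    inputInfo (p ∘ e) (Q ∘ e) = inputInfo p Q := by
  simp only [inputInfo, homShannon, Function.comp_apply, e.sum_comp fun x => eta (p x)]
  congr 1
  refine Finset.sum_congr rfl fun y _ => ?_
  rw [e.sum_comp fun x => eta (p x * Q x y), e.sum_comp fun x => p x * Q x y]

theorem outputInfo_equiv (e : X₁ ≃ X) (f : B₁ ≃ B) (hρ : ∀ x, IsDensity (ρ x)) (Q : X → Y → ℝ) :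
    outputInfo (p ∘ e) (fun x => (ρ (e x)).submatrix f f) (Q ∘ e) = outputInfo p ρ Q := by
  have h : ∀ c : X → ℝ, ∑ x, (c (e x) : ℂ) • (ρ (e x)).submatrix f f =
      Matrix.reindex f.symm f.symm (∑ x, (c x : ℂ) • ρ x) := by
    intro c
    rw [← e.sum_comp]
    ext i j
    simp [Matrix.sum_apply]
  have hH : ∀ c : X → ℝ, homEntropy (Matrix.reindex f.symm f.symm (∑ x, (c x : ℂ) • ρ x)) =
      homEntropy (∑ x, (c x : ℂ) • ρ x) := by
    intro c
    rw [homEntropy, homEntropy, entropy_reindex _ (isHermitian_smul_sum hρ c)]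
    congr 3
    exact f.sum_comp fun i => (∑ x, (c x : ℂ) • ρ x) i i
  simp only [outputInfo, condState, Function.comp_apply]
  rw [h, entropy_reindex _ (isHermitian_smul_sum hρ p)]
  congr 1
  refine Finset.sum_congr rfl fun y _ => ?_
  rw [h fun x => p x * Q x y, hH]

theorem powDist_mem_stdSimplex [DecidableEq X] (hp : p ∈ stdSimplex ℝ X) (n : ℕ) :
    powDist n p ∈ stdSimplex ℝ (Fin n → X) := by
  refine ⟨fun x => Finset.prod_nonneg fun k _ => hp.1 _, ?_⟩
  have := Finset.prod_univ_sum (fun _ : Fin n => (Finset.univ : Finset X)) fun _ x => p x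
  rw [Fintype.piFinset_univ] at this
  simp only [powDist]
  rw [← this]
  simp [hp.2]

omit [Fintype X] in
theorem powDist_succ (n : ℕ) :
    powDist (n + 1) p ∘ Fin.consEquiv (fun _ => X) = prodDist p (powDist n p) := by
  funext x
  simp [powDist, prodDist, Fin.prod_univ_succ]

omit [Fintype X] [Fintype B] [DecidableEq B] in
theorem powStates_succ (n : ℕ) :
    (fun x => (powStates (n + 1) ρ (Fin.consEquiv (fun _ => X) x)).submatrix
      (Fin.consEquiv fun _ => B) (Fin.consEquiv fun _ => B)) =
      prodStates ρ (powStates n ρ) := by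
  funext x
  ext i j
  simp [powStates, prodStates, Fin.prod_univ_succ]

omit [Fintype X] in
theorem powStates_isDensity (hρ : ∀ x, IsDensity (ρ x)) (n : ℕ) (x : Fin n → X) :
    IsDensity (powStates n ρ x) := by
  constructor
  · induction n with
    | zero =>
      have : powStates 0 ρ x = 1 := by
        ext i j; rw [Subsingleton.elim i j]; simp [powStates]
      rw [this]; exact Matrix.PosSemidef.one
    | succ n ih =>
      have h := congrFun (powStates_succ (ρ := ρ) n) (x 0, Fin.tail x)
      have h2 : powStates (n + 1) ρ x = (prodStates ρ (powStates n ρ) (x 0, Fin.tail x)).submatrix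
          (Fin.consEquiv fun _ => B).symm (Fin.consEquiv fun _ => B).symm := by
        rw [← h]
        ext i j
        simp [Fin.consEquiv]
      rw [h2]
      exact ((hρ _).1.kronecker (ih _)).submatrix _
  · have := Finset.prod_univ_sum (fun _ : Fin n => (Finset.univ : Finset B))
      fun k b => ρ (x k) b b
    rw [Fintype.piFinset_univ] at this
    change ∑ b : Fin n → B, ∏ k, ρ (x k) (b k) (b k) = 1
    rw [← this]
    exact Finset.prod_eq_one fun k _ => (hρ (x k)).2

theorem inputInfo_powDist_zero (p : X → ℝ) {Q : (Fin 0 → X) → Y → ℝ} :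
    inputInfo (powDist 0 p) Q = 0 := by
  simp [inputInfo, homShannon, powDist]

theorem outputInfo_powDist_zero (hρ : ∀ x, IsDensity (ρ x)) (Q : (Fin 0 → X) → Y → ℝ) :
    outputInfo (powDist 0 p) (powStates 0 ρ) Q = 0 := by
  have h : ∀ M : Matrix (Fin 0 → B) (Fin 0 → B) ℂ, M.IsHermitian → homEntropy M = 0 := by
    intro M hM
    have : M = Matrix.diagonal fun _ => (M.trace.re : ℂ) := by
      rw [← trace_eq_re hM]
      ext i j
      simp [Subsingleton.elim i default, Subsingleton.elim j default, Matrix.trace]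
    rw [homEntropy]
    conv_lhs => enter [1]; rw [this]
    rw [entropy_diagonal]; simp
  have hS : entropy (∑ x, (powDist 0 p x : ℂ) • powStates 0 ρ x) = 0 := by
    have := h _ (isHermitian_smul_sum (powStates_isDensity hρ 0) (powDist 0 p))
    rw [homEntropy] at this
    rw [sub_eq_zero.1 this]
    have h1 : (∑ x, (powDist 0 p x : ℂ) • powStates 0 ρ x).trace.re = 1 := by
      simp [powDist, (powStates_isDensity hρ 0 _).2]
    rw [h1, eta_one]
  rw [outputInfo, hS]
  simp only [h _ (condState_isHermitian (powStates_isDensity hρ 0) Q _)]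
  simp

/-- Any channel on `n` copies is, per copy, no better than some channel on a single copy: the first
copy and the remaining ones are split off by the chain rule, and the resulting single-copy channels
are time-shared. -/
theorem exists_single_letter [DecidableEq X] (hp : p ∈ stdSimplex ℝ X)
    (hρ : ∀ x, IsDensity (ρ x)) (n : ℕ) :
    ∀ (m : ℕ) (Q : (Fin n → X) → Fin m → ℝ), IsChannel Q →
      ∃ (m' : ℕ) (Q' : X → Fin m' → ℝ), IsChannel Q' ∧
        inputInfo (powDist n p) Q = n * inputInfo p Q' ∧
        outputInfo (powDist n p) (powStates n ρ) Q ≤ n * outputInfo p ρ Q' := by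
  induction n with
  | zero =>
    intro m Q hQ
    refine ⟨1, fun _ _ => 1, fun x => ⟨fun _ => zero_le_one, by simp⟩, ?_, ?_⟩
    · simp [inputInfo_powDist_zero]
    · simp [outputInfo_powDist_zero hρ]
  | succ n ih =>
    intro m Q hQ
    have hpn := powDist_mem_stdSimplex hp n
    have hρn := powStates_isDensity hρ n
    set e := Fin.consEquiv (n := n) (fun _ => X)
    have hQe : IsChannel (Q ∘ e) := fun x => hQ (e x)
    have hin : inputInfo (powDist (n + 1) p) Q = inputInfo (prodDist p (powDist n p)) (Q ∘ e) := by
      rw [← inputInfo_equiv e, powDist_succ]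
    have hout : outputInfo (powDist (n + 1) p) (powStates (n + 1) ρ) Q =
        outputInfo (prodDist p (powDist n p)) (prodStates ρ (powStates n ρ)) (Q ∘ e) := by
      rw [← outputInfo_equiv e (Fin.consEquiv fun _ => B) (powStates_isDensity hρ (n + 1)),
        powDist_succ, powStates_succ]
    -- weights `1/(n+1)` and `n/(n+1)` give the average over the `n + 1` copies
    obtain ⟨m₂, Q₂, h1, h2, h3⟩ := exists_channel_fin (p := powDist n p) hρn
      (isChannel_revealingChannel hp hQe)
    obtain ⟨m₃, Q₃, h4, h5, h6⟩ := ih m₂ Q₂ h1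
    have hn : (0 : ℝ) < n + 1 := by positivity
    have ha : (0 : ℝ) ≤ 1 / (n + 1) := by positivity
    have hb : (0 : ℝ) ≤ n / (n + 1) := by positivity
    have hab : (1 : ℝ) / (n + 1) + n / (n + 1) = 1 := by field_simp; ring
    obtain ⟨m', Q', h7, h8, h9⟩ := exists_channel_fin (p := p) hρ
      (isChannel_mixChannel ha hb hab (isChannel_marginalChannel hpn hQe) h4)
    refine ⟨m', Q', h7, ?_, ?_⟩
    · rw [hin, inputInfo_prodDist hp hpn, h8, inputInfo_mixChannel hab, ← h2, h5]
      push_cast; field_simp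
    · rw [hout, h9, outputInfo_mixChannel hab hρ]
      refine (outputInfo_prod_le hp hpn hρ hρn hQe).trans ?_
      rw [← h3]
      refine (add_le_add_right h6 _).trans_eq ?_
      push_cast; field_simp

/-- `n` parallel uses of a channel. -/
theorem exists_power_channel [DecidableEq X] (hp : p ∈ stdSimplex ℝ X)
    (hρ : ∀ x, IsDensity (ρ x)) {m : ℕ}
    {Q : X → Fin m → ℝ} (hQ : IsChannel Q) (n : ℕ) :
    ∃ (m' : ℕ) (Q' : (Fin n → X) → Fin m' → ℝ), IsChannel Q' ∧
        inputInfo (powDist n p) Q' = n * inputInfo p Q ∧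
        outputInfo (powDist n p) (powStates n ρ) Q' = n * outputInfo p ρ Q := by
  induction n with
  | zero =>
    refine ⟨1, fun _ _ => 1, fun x => ⟨fun _ => zero_le_one, by simp⟩, ?_, ?_⟩
    · simp [inputInfo_powDist_zero]
    · simp [outputInfo_powDist_zero hρ]
  | succ n ih =>
    obtain ⟨m₂, Q₂, h1, h2, h3⟩ := ih
    have hpn := powDist_mem_stdSimplex hp n
    have hρn := powStates_isDensity hρ n
    set e := Fin.consEquiv (n := n) (fun _ => X)
    have hprod := isChannel_prodChannel hQ h1
    have hR : IsChannel (prodChannel Q Q₂ ∘ e.symm) := fun x => hprod (e.symm x)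
    obtain ⟨m', Q', h4, h5, h6⟩ := exists_channel_fin (p := powDist (n + 1) p)
      (powStates_isDensity hρ (n + 1)) hR
    have hcomp : (prodChannel Q Q₂ ∘ e.symm) ∘ e = prodChannel Q Q₂ := by
      funext x; simp
    refine ⟨m', Q', h4, ?_, ?_⟩
    · rw [h5, ← inputInfo_equiv e, powDist_succ, hcomp, inputInfo_prodChannel hp hpn hQ h1, h2]
      push_cast; ring
    · rw [h6, ← outputInfo_equiv e (Fin.consEquiv fun _ => B) (powStates_isDensity hρ (n + 1)),
        powDist_succ, powStates_succ, hcomp, outputInfo_prodChannel hp hpn hρ hρn hQ h1, h3]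
      push_cast; ring

end Product

/-! ### The tradeoff curves -/

section SingleLetter

variable {X B E : Type*} [Fintype X] [DecidableEq X] [Fintype B] [DecidableEq B]
  [Fintype E] [DecidableEq E] {p : X → ℝ} {ρ : X → Matrix B B ℂ} {ψ : X × B × E → ℂ}

/-- The normalized `n`-copy problem has the same value as the single-copy one. -/
theorem isGreatest_pow (hp : p ∈ stdSimplex ℝ X) (hρ : ∀ x, IsDensity (ρ x)) {c r : ℝ}
    (hc : 0 ≤ c) {k : ℕ} {Q : X → Fin k → ℝ} (hQ : IsOptimalChannel p ρ c r Q) {n : ℕ}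
    (hn : 1 ≤ n) :
    IsGreatest {v | ∃ (m : ℕ) (Q' : (Fin n → X) → Fin m → ℝ), IsChannel Q' ∧
      1 / (n : ℝ) * (inputInfo (powDist n p) Q' -
        c * outputInfo (powDist n p) (powStates n ρ) Q') ≤ r ∧
      v = 1 / (n : ℝ) * outputInfo (powDist n p) (powStates n ρ) Q'} (outputInfo p ρ Q) := by
  have hn0 : (0 : ℝ) < n := by exact_mod_cast hn
  have hcancel : ∀ x : ℝ, 1 / (n : ℝ) * (n * x) = x := fun x => by field_simp
  constructor
  · obtain ⟨m, Q', h1, h2, h3⟩ := exists_power_channel hp hρ hQ.1 n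
    refine ⟨m, Q', h1, ?_, ?_⟩
    · rw [h2, h3, show n * inputInfo p Q - c * (n * outputInfo p ρ Q) =
        n * (inputInfo p Q - c * outputInfo p ρ Q) by ring, hcancel]
      exact hQ.2.1
    · rw [h3, hcancel]
  · rintro v ⟨m, Q', h1, h2, rfl⟩
    obtain ⟨m', Q'', h3, h4, h5⟩ := exists_single_letter hp hρ n m Q' h1
    have h6 : 1 / (n : ℝ) * outputInfo (powDist n p) (powStates n ρ) Q' ≤ outputInfo p ρ Q'' := by
      rw [← hcancel (outputInfo p ρ Q'')]
      exact mul_le_mul_of_nonneg_left h5 (by positivity)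
    refine h6.trans (hQ.2.2 m' Q'' h3 (le_trans ?_ h2))
    rw [mul_sub, h4, hcancel, mul_left_comm]
    exact sub_le_sub_left (mul_le_mul_of_nonneg_left h6 hc) _

theorem purityValues_eq (hp : p ∈ stdSimplex ℝ X) (hρ : ∀ x, IsDensity (ρ x))
    (hψ : IsPurification ψ (cqState p ρ)) (n : ℕ) (R : ℝ) :
    purityValues n ψ R = {v | ∃ (m : ℕ) (Q : (Fin n → X) → Fin m → ℝ), IsChannel Q ∧
      1 / (n : ℝ) * (inputInfo (powDist n p) Q -
        0 * outputInfo (powDist n p) (powStates n ρ) Q) ≤ R ∧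
      v = 1 / (n : ℝ) * outputInfo (powDist n p) (powStates n ρ) Q} := by
  have hρn := powStates_isDensity hρ n
  have hψn := isPurification_vecPow n hψ
  ext v
  refine exists_congr fun m => exists_congr fun Q => and_congr_right fun hQ => ?_
  rw [infoYBE_channelPOVM (powDist_mem_stdSimplex hp n).1 hρn hψn hQ,
    infoYB_eq hρn hψn (isPOVM_channelPOVM hQ), zero_mul, sub_zero]
  simp [channelPOVM]

theorem crValues_eq (hρ : ∀ x, IsDensity (ρ x)) (n : ℕ) (R : ℝ) :
    crValues n (cqState p ρ) R = {v | ∃ (m : ℕ) (Q : (Fin n → X) → Fin m → ℝ), IsChannel Q ∧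
      1 / (n : ℝ) * (inputInfo (powDist n p) Q -
        1 * outputInfo (powDist n p) (powStates n ρ) Q) ≤ R ∧
      v = 1 / (n : ℝ) * outputInfo (powDist n p) (powStates n ρ) Q} := by
  have hρn := powStates_isDensity hρ n
  ext v
  refine exists_congr fun m => exists_congr fun Q => and_congr_right fun hQ => ?_
  rw [statePow_cqState, mutualInfo_jointYX hρn hQ, mutualInfo_measured_channelPOVM hρn hQ, one_mul]

theorem isGreatest_purityValues (hp : p ∈ stdSimplex ℝ X) (hρ : ∀ x, IsDensity (ρ x))
    (hψ : IsPurification ψ (cqState p ρ)) {n : ℕ} (hn : 1 ≤ n) {R : ℝ} {k : ℕ}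
    {Q : X → Fin k → ℝ} (hQ : IsOptimalChannel p ρ 0 R Q) :
    IsGreatest (purityValues n ψ R) (outputInfo p ρ Q) := by
  rw [purityValues_eq hp hρ hψ]
  exact isGreatest_pow hp hρ le_rfl hQ hn

theorem isGreatest_crValues (hp : p ∈ stdSimplex ℝ X) (hρ : ∀ x, IsDensity (ρ x))
    {n : ℕ} (hn : 1 ≤ n) {R : ℝ} {k : ℕ} {Q : X → Fin k → ℝ} (hQ : IsOptimalChannel p ρ 1 R Q) :
    IsGreatest (crValues n (cqState p ρ) R) (outputInfo p ρ Q) := by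
  rw [crValues_eq hρ]
  exact isGreatest_pow hp hρ zero_le_one hQ hn

omit [DecidableEq X] in
/-- The two tradeoffs are the same curve in different coordinates. -/
theorem outputInfo_optimal_eq {Q Q' : X → Fin (Fintype.card X + 2) → ℝ} {R : ℝ}
    (hQ : IsOptimalChannel p ρ 1 R Q) (hQ' : IsOptimalChannel p ρ 0 (outputInfo p ρ Q + R) Q') :
    outputInfo p ρ Q' = outputInfo p ρ Q := by
  refine le_antisymm ?_ (hQ'.2.2 _ Q hQ.1 ?_)
  · by_contra! h
    have h1 := hQ'.2.1
    exact absurd (hQ.2.2 _ Q' hQ'.1 (by linarith)) (not_le.2 h)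
  · have := hQ.2.1
    linarith

/-- General measurements do not improve on channels: the constraint becomes stricter when the
measurement is not diagonal, and the objective only depends on the diagonal. -/
theorem povmPurity_vecPow (hp : p ∈ stdSimplex ℝ X) (hρ : ∀ x, IsDensity (ρ x))
    (hψ : IsPurification ψ (cqState p ρ)) {n : ℕ} (hn : 1 ≤ n) {R : ℝ} {k : ℕ}
    {Q : X → Fin k → ℝ} (hQ : IsOptimalChannel p ρ 0 R Q) :
    1 / (n : ℝ) * povmPurity (vecPow n ψ) (n * R) = outputInfo p ρ Q := by
  have hρn := powStates_isDensity hρ n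
  have hψn := isPurification_vecPow n hψ
  have hpn := powDist_mem_stdSimplex hp n
  have hn0 : (0 : ℝ) < n := by exact_mod_cast hn
  have hg := isGreatest_purityValues hp hρ hψ hn hQ
  have hmax : IsGreatest {v | ∃ (m : ℕ) (Λ : Fin m → Matrix (Fin n → X) (Fin n → X) ℂ), IsPOVM Λ ∧
      infoYBE Λ (vecPow n ψ) ≤ n * R ∧ v = infoYB Λ (vecPow n ψ)} (n * outputInfo p ρ Q) := by
    constructor
    · obtain ⟨m, Q', h1, h2, h3⟩ := hg.1
      refine ⟨m, channelPOVM Q', isPOVM_channelPOVM h1, ?_, ?_⟩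
      · rw [one_div, inv_mul_le_iff₀ hn0] at h2
        exact h2
      · rw [h3]; field_simp
    · rintro v ⟨m, Λ, h1, h2, rfl⟩
      have hch := isChannel_diag h1
      have h3 : 1 / (n : ℝ) * infoYB Λ (vecPow n ψ) ∈ purityValues n ψ R := by
        refine ⟨m, _, hch, ?_, ?_⟩
        · rw [one_div, inv_mul_le_iff₀ hn0, infoYBE_channelPOVM hpn.1 hρn hψn hch]
          exact (inputInfo_le_infoYBE hpn.1 hρn hψn h1).trans h2
        · rw [infoYB_eq hρn hψn h1, infoYB_eq hρn hψn (isPOVM_channelPOVM hch)]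
          simp [channelPOVM]
      have h4 := hg.2 h3
      rwa [one_div, inv_mul_le_iff₀ hn0] at h4
  rw [povmPurity, hmax.csSup_eq]
  field_simp

end SingleLetter

end LocalPurity

theorem mainTheorem2 {X B E : Type*} [Fintype X] [DecidableEq X] [Fintype B] [DecidableEq B]
    [Fintype E] [DecidableEq E]
    (p : X → ℝ) (hp : p ∈ stdSimplex ℝ X)
    (ρ : X → Matrix B B ℂ) (hρ : ∀ x, LocalPurity.IsDensity (ρ x))
    (ψ : X × B × E → ℂ) (hψ : LocalPurity.IsPurification ψ (LocalPurity.cqState p ρ)) :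
    (∀ n : ℕ, 1 ≤ n → ∀ R : ℝ, 0 ≤ R →
      -- the maxima defining `P_n(R)` and `D_n(R)` exist
      IsGreatest (LocalPurity.purityValues n ψ R) (LocalPurity.purity n ψ R) ∧
      IsGreatest (LocalPurity.crValues n (LocalPurity.cqState p ρ) R)
        (LocalPurity.commonRandomness n (LocalPurity.cqState p ρ) R) ∧
      -- `P_n(D_n(R) + R) = D_n(R)`
      LocalPurity.purity n ψ
          (LocalPurity.commonRandomness n (LocalPurity.cqState p ρ) R + R) =
        LocalPurity.commonRandomness n (LocalPurity.cqState p ρ) R ∧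
      -- `P_n(R) = P_1(R)`
      LocalPurity.purity n ψ R = LocalPurity.purity 1 ψ R) ∧
    (∀ R : ℝ, 0 ≤ R →
      -- the regularized purity tradeoff (over all POVMs on `Xⁿ`) equals `P_1(R)`
      Filter.Tendsto
        (fun n : ℕ => 1 / (n : ℝ) *
          LocalPurity.povmPurity (LocalPurity.vecPow n ψ) ((n : ℝ) * R))
        Filter.atTop (𝓝 (LocalPurity.purity 1 ψ R)) ∧
      -- the maximum `P_1(R)` is a finite-dimensional one: `|X| + 2` output letters suffice
      ∃ Q : (Fin 1 → X) → Fin (Fintype.card X + 2) → ℝ, LocalPurity.IsChannel Q ∧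
        LocalPurity.infoYBE (LocalPurity.channelPOVM Q) (LocalPurity.vecPow 1 ψ) ≤ R ∧
        LocalPurity.infoYB (LocalPurity.channelPOVM Q) (LocalPurity.vecPow 1 ψ) =
          LocalPurity.purity 1 ψ R) := by
  open LocalPurity in
  refine ⟨fun n hn R hR => ?_, fun R hR => ?_⟩
  · obtain ⟨QP, hP⟩ := exists_optimal_channel hp hρ 0 hR
    obtain ⟨QD, hD⟩ := exists_optimal_channel hp hρ 1 hR
    have hgP := isGreatest_purityValues hp hρ hψ hn hP
    have hgD := isGreatest_crValues hp hρ hn hD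
    have hgP1 := isGreatest_purityValues hp hρ hψ le_rfl hP
    have hPn : purity n ψ R = outputInfo p ρ QP := hgP.csSup_eq
    have hP1 : purity 1 ψ R = outputInfo p ρ QP := hgP1.csSup_eq
    have hDn : commonRandomness n (cqState p ρ) R = outputInfo p ρ QD := hgD.csSup_eq
    -- the constant channel is feasible, hence `D_n(R) ≥ 0`
    have hDR : 0 ≤ outputInfo p ρ QD + R := by
      have h := hD.2.2 1 _ (isChannel_const X) (by
        rwa [inputInfo_const hp, outputInfo_const hp hρ, mul_zero, sub_zero])
      rw [outputInfo_const hp hρ] at h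
      exact add_nonneg h hR
    obtain ⟨QS, hS⟩ := exists_optimal_channel hp hρ 0 hDR
    refine ⟨hPn ▸ hgP, hDn ▸ hgD, ?_, hPn.trans hP1.symm⟩
    rw [hDn]
    have hgS := isGreatest_purityValues hp hρ hψ hn hS
    exact hgS.csSup_eq.trans (outputInfo_optimal_eq hD hS)
  · obtain ⟨QP, hP⟩ := exists_optimal_channel hp hρ 0 hR
    have hg := isGreatest_purityValues hp hρ hψ le_rfl hP
    have hP1 : purity 1 ψ R = outputInfo p ρ QP := hg.csSup_eq
    constructor
    · rw [hP1]
      refine tendsto_const_nhds.congr' ?_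
      filter_upwards [Filter.eventually_ge_atTop 1] with n hn
      exact (povmPurity_vecPow hp hρ hψ hn hP).symm
    · obtain ⟨m, Q, h1, h2, h3⟩ := hg.1
      have hρn := powStates_isDensity hρ 1
      have hψn := isPurification_vecPow 1 hψ
      have hpn := powDist_mem_stdSimplex hp 1
      obtain ⟨Q', h4, h5, h6⟩ := exists_channel_card (p := powDist 1 p) hρn h1
        (k := Fintype.card X + 2) (by simp)
      have hYB : ∀ {m : ℕ} {Q : (Fin 1 → X) → Fin m → ℝ}, IsChannel Q →
          infoYB (channelPOVM Q) (vecPow 1 ψ) = outputInfo (powDist 1 p) (powStates 1 ρ) Q := by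
        intro m Q hQ
        rw [infoYB_eq hρn hψn (isPOVM_channelPOVM hQ)]
        simp [channelPOVM]
      refine ⟨Q', h4, ?_, ?_⟩
      · rw [infoYBE_channelPOVM hpn.1 hρn hψn h4, h5, ← infoYBE_channelPOVM hpn.1 hρn hψn h1]
        simpa using h2
      · rw [hP1, h3, hYB h4, hYB h1, h6]; simp
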